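/- Let $G$ be a nonabelian group with an involution $g\mapsto g^*$ (an antiautomorphism of order two) such that $gg^*$ is central for every $g\in G$, and let $g_0$ be a central element of $G$ with $g_0^*=g_0$. The loop $L=M(G,*,g_0)$ is the set $G\cup Gu$, with the product that extends that of $G$ by $$g(hu)=(hg)u,\qquad (gu)h=(gh^*)u,\qquad (gu)(hu)=g_0h^*g\qquad(g,h\in G).$$ $L$ is called RA if, for every nonzero commutative associative ring $R$ with $1$, the loop ring $RL$ is alternative (that is, $(yx)x=yx^2$ and $x(xy)=x^2y$ hold in it) but not associative. Let $L=M(G,*,g_0)$ be a finite RA loop and $K$ a field whose characteristic does not divide $|L|$. Then the group algebra $KG=\bigoplus_i A_i$ is the direct sum of finitely many two-sided ideals $A_i$ that are simple algebras. For every such decomposition: 1. each $A_i$ is a field or a quaternion algebra over a field extension of $K$; 2. the loop algebra $KL=\bigoplus_i B_i$ is the direct sum of the two-sided ideals $B_i=A_i+A_iu$; 3. if $A_i$ is a field, then $B_i$ is either a field or isomorphic as a $K$-algebra to the direct sum $A_i\oplus A_i$ of two fields; if $A_i$ is a quaternion algebra, then $B_i$ is a Cayley algebra (an algebra $Q+Q\ell$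 with $Q$ a quaternion algebra over a field $F$, $0\ne c\in F$, and product $(p+q\ell)(r+t\ell)=(pr+c\,\bar t q)+(tp+q\bar r)\ell$). In particular, $B_i$ is simple except when it is a sum $A_i\oplus A_i$ of two fields. Suppose moreover that $L$ lies in one of the following classes $\mathcal L_1,\dots,\mathcal L_5$. In each of them $G$ is the group with generators $x,y$ and the listed $t_j$, and with the relations: all $t_j$ are central, $t_j^{2^{m_j}}=1$ where the $m_j\ge 1$ are arbitrary, $x^{-1}y^{-1}xy=t_1^{2^{m_1-1}}$, and those given here, together with $g_0$: - $\mathcal L_1$: generators $x,y,t_1$; $x^2=1$, $y^2=1$; $g_0=1$. - $\mathcal L_2$: generators $x,y,t_1$; $x^2=t_1$, $y^2=t_1$; $g_0=t_1$. - $\mathcal L_3$: generators $x,y,t_1,t_2$; $x^2=1$, $y^2=t_2$; $g_0=1$. - $\mathcal L_4$: generators $x,y,t_1,t_2$; $x^2=t_1$, $y^2=t_2$; $g_0=t_1$. - $\mathcal L_5$: generators $x,y,t_1,t_2,t_3$; $x^2=t_2$, $y^2=t_3$; $g_0=1$. If $KG$ is the direct sum of $n$ ideals that are fields and $m$ ideals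 that are quaternion algebras, then $KL$ is the direct sum of $2n$ ideals that are fields and $m$ ideals that are Cayley algebras. -/

import Mathlib

universe u v w

/-! ### The loops `M(G, *, g₀)` -/

/-- A nonabelian group `G` with an involution `g ↦ g*` (an antiautomorphism of order two) such that
`g g*` is central for all `g`, and a central element `g₀` fixed by the involution.
(As `G` is nonabelian, the involution is automatically not the identity.) -/
structure DoublingDatum (G : Type u) [Group G] where
  star : G → G
  star_star : ∀ g, star (star g) = g
  star_mul : ∀ g h, star (g * h) = star h * star g
  mul_star_mem_center : ∀ g, g * star g ∈ Subgroup.center G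
  g₀ : G
  g₀_mem_center : g₀ ∈ Subgroup.center G
  star_g₀ : star g₀ = g₀
  nonabelian : ∃ g h : G, g * h ≠ h * g

theorem DoublingDatum.star_one {G : Type u} [Group G] (D : DoublingDatum G) : D.star 1 = 1 := by
  have h := D.star_mul 1 1
  rw [mul_one] at h
  exact left_eq_mul.mp h

/-- The loop `M(G, *, g₀) = G ∪ Gu`: `inG g` is the element `g`, and `inGu g` is the element `gu`. -/
inductive DoubledLoop {G : Type u} [Group G] (D : DoublingDatum G) : Type u
  | inG (g : G) : DoubledLoop D
  | inGu (g : G) : DoubledLoop D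

namespace DoubledLoop

variable {G : Type u} [Group G] {D : DoublingDatum G}

/-- The product: `g(hu) = (hg)u`, `(gu)h = (gh*)u`, `(gu)(hu) = g₀h*g`. -/
protected def mul : DoubledLoop D → DoubledLoop D → DoubledLoop D
  | inG g, inG h => inG (g * h)
  | inG g, inGu h => inGu (h * g)
  | inGu g, inG h => inGu (g * D.star h)
  | inGu g, inGu h => inG (D.g₀ * D.star h * g)

instance : MulOneClass (DoubledLoop D) where
  one := inG 1
  mul := DoubledLoop.mul
  one_mul a := by
    cases a with
    | inG g => exact congrArg inG (one_mul g)
    | inGu g => exact congrArg inGu (mul_one g)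
  mul_one a := by
    cases a with
    | inG g => exact congrArg inG (mul_one g)
    | inGu g => exact congrArg inGu (by rw [D.star_one, mul_one])

end DoubledLoop

/-! ### RA loops -/

/-- The left and right alternative laws. -/
def IsAlternativeMul (R : Type u) [Mul R] : Prop :=
  ∀ x y : R, (y * x) * x = y * (x * x) ∧ x * (x * y) = (x * x) * y

/-- `L` is RA (ring alternative): over every nonzero commutative associative coefficient ring `R`
with `1`, the loop ring `RL` is alternative but not associative. -/
def IsRALoop (L : Type u) [MulOneClass L] : Prop :=
  ∀ (R : Type) [CommRing R] [Nontrivial R],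
    IsAlternativeMul (MonoidAlgebra R L) ∧
      ¬ ∀ x y z : MonoidAlgebra R L, (x * y) * z = x * (y * z)

/-! ### Cayley algebras -/

/-- The Cayley algebra over `F` obtained by doubling the quaternion algebra `Q = (a, b / F)` with
the parameter `c`: it is `Q ⊕ Qℓ`, the pair `(p, q)` being `p + qℓ`. -/
structure CayleyAlgebra (F : Type u) [Field F] (a b c : F) : Type u where
  toProd : QuaternionAlgebra F a 0 b × QuaternionAlgebra F a 0 b

namespace CayleyAlgebra

variable {F : Type u} [Field F] {a b c : F}

/-- The underlying bijection with the pairs of quaternions. -/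
def equivProd : CayleyAlgebra F a b c ≃ QuaternionAlgebra F a 0 b × QuaternionAlgebra F a 0 b where
  toFun := toProd
  invFun := mk
  left_inv _ := rfl
  right_inv _ := rfl

instance : AddCommGroup (CayleyAlgebra F a b c) := equivProd.addCommGroup

instance {K : Type v} [Field K] [Algebra K F] : Module K (CayleyAlgebra F a b c) :=
  equivProd.module K

/-- `(p + qℓ)(r + tℓ) = (pr + c t̄ q) + (tp + q r̄)ℓ`. -/
instance : Mul (CayleyAlgebra F a b c) where
  mul x y :=
    ⟨(x.toProd.1 * y.toProd.1 + c • (star y.toProd.2 * x.toProd.2),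
      y.toProd.2 * x.toProd.1 + x.toProd.2 * star y.toProd.1)⟩

theorem ext' {x y : CayleyAlgebra F a b c} (h : x.toProd = y.toProd) : x = y :=
  equivProd.injective h

theorem toProd_add (x y : CayleyAlgebra F a b c) : (x + y).toProd = x.toProd + y.toProd := rfl

theorem toProd_zero : (0 : CayleyAlgebra F a b c).toProd = 0 := rfl

theorem toProd_mul (x y : CayleyAlgebra F a b c) : (x * y).toProd =
    (x.toProd.1 * y.toProd.1 + c • (star y.toProd.2 * x.toProd.2),
      y.toProd.2 * x.toProd.1 + x.toProd.2 * star y.toProd.1) := rfl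

instance : NonUnitalNonAssocRing (CayleyAlgebra F a b c) where
  left_distrib x y z := ext' <| by
    ext1 <;> simp only [toProd_mul, toProd_add, Prod.fst_add, Prod.snd_add, star_add, mul_add,
      add_mul, smul_add] <;> abel
  right_distrib x y z := ext' <| by
    ext1 <;> simp only [toProd_mul, toProd_add, Prod.fst_add, Prod.snd_add, mul_add,
      add_mul, smul_add] <;> abel
  zero_mul x := ext' <| by
    ext1 <;> simp only [toProd_mul, toProd_zero, Prod.fst_zero, Prod.snd_zero, zero_mul, mul_zero,
      smul_zero, add_zero]
  mul_zero x := ext' <| by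
    ext1 <;> simp only [toProd_mul, toProd_zero, Prod.fst_zero, Prod.snd_zero, zero_mul, mul_zero,
      smul_zero, add_zero, star_zero]

end CayleyAlgebra

/-! ### Ideals and direct sums of ideals in a (not necessarily associative) `K`-algebra -/

section Ideals

variable {K : Type u} [Field K] {R : Type v} [NonUnitalNonAssocRing R] [Module K R]

/-- A two-sided ideal of the `K`-algebra `R`. -/
def IsAlgIdeal (I : Submodule K R) : Prop :=
  ∀ a : R, ∀ x ∈ I, a * x ∈ I ∧ x * a ∈ I

/-- `R` is the direct sum of the two-sided ideals `A i`. -/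
def IsIdealDecomposition {ι : Type} [DecidableEq ι] (A : ι → Submodule K R) : Prop :=
  (∀ i, IsAlgIdeal (A i)) ∧ DirectSum.IsInternal A

/-- A subspace `I` closed under multiplication is a simple algebra: the multiplication of `I` is
not zero, and `I` has no two-sided ideals besides `0` and `I`. -/
def IsSimpleAlg (I : Submodule K R) : Prop :=
  (∀ x ∈ I, ∀ y ∈ I, x * y ∈ I) ∧ (∃ x ∈ I, ∃ y ∈ I, x * y ≠ 0) ∧
    ∀ J : Submodule K R, J ≤ I → (∀ a ∈ I, ∀ x ∈ J, a * x ∈ J ∧ x * a ∈ J) → J = ⊥ ∨ J = I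

/-- With the operations of `R`, the subspace `I` is an algebra isomorphic to `C`. -/
def IsCopyOf (I : Submodule K R) (C : Type w) [NonUnitalNonAssocRing C] [Module K C] : Prop :=
  ∃ f : C →ₙₐ[K] R, Function.Injective f ∧ Set.range f = (I : Set R)

/-- `I` is a field (an extension field of `K`). -/
def IsFieldAlg (I : Submodule K R) : Prop :=
  ∃ (F : Type v) (_ : Field F) (_ : Algebra K F), IsCopyOf I F

/-- `I` is the direct sum of two copies of the field `A`. -/
def IsTwoCopiesOfField {R' : Type w} [NonUnitalNonAssocRing R'] [Module K R']
    (I : Submodule K R) (A : Submodule K R') : Prop :=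
  ∃ (F : Type w) (_ : Field F) (_ : Algebra K F), IsCopyOf A F ∧ IsCopyOf I (F × F)

/-- `I` is a quaternion algebra `(a, b / F)` over an extension field `F` of `K`: its basis is
`1, i, j, ij` with `i² = a`, `j² = b`, `ij = -ji`, where `a` and `b` are not zero. -/
def IsQuaternionAlg (I : Submodule K R) : Prop :=
  ∃ (F : Type v) (_ : Field F) (_ : Algebra K F) (a b : F), (2 : F) ≠ 0 ∧ a ≠ 0 ∧ b ≠ 0 ∧
    IsCopyOf I (QuaternionAlgebra F a 0 b)

/-- `I` is a Cayley algebra over an extension field `F` of `K`. -/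
def IsCayleyAlg (I : Submodule K R) : Prop :=
  ∃ (F : Type v) (_ : Field F) (_ : Algebra K F) (a b c : F), (2 : F) ≠ 0 ∧ a ≠ 0 ∧ b ≠ 0 ∧
    c ≠ 0 ∧ IsCopyOf I (CayleyAlgebra F a b c)

variable (K R)

/-- `R` is the direct sum of `n` ideals that are fields and `m` ideals that are quaternion
algebras. -/
def IsSumOfFieldsAndQuaternionAlgs (n m : ℕ) : Prop :=
  ∃ A : Fin n ⊕ Fin m → Submodule K R, IsIdealDecomposition A ∧
    (∀ i, IsFieldAlg (A (Sum.inl i))) ∧ ∀ j, IsQuaternionAlg (A (Sum.inr j))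

/-- `R` is the direct sum of `n` ideals that are fields and `m` ideals that are Cayley algebras. -/
def IsSumOfFieldsAndCayleyAlgs (n m : ℕ) : Prop :=
  ∃ A : Fin n ⊕ Fin m → Submodule K R, IsIdealDecomposition A ∧
    (∀ i, IsFieldAlg (A (Sum.inl i))) ∧ ∀ j, IsCayleyAlg (A (Sum.inr j))

end Ideals

/-! ### The subspaces `A + Au` of the loop algebra -/

/-- The embedding `KG → KL`. -/
noncomputable def groupAlgToLoopAlg (K : Type v) [Field K] {G : Type u} [Group G]
    (D : DoublingDatum G) : MonoidAlgebra K G →ₗ[K] MonoidAlgebra K (DoubledLoop D) :=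
  MonoidAlgebra.mapDomainLinearMap K K DoubledLoop.inG

/-- The subspace `A + Au` of `KL = KG + KGu`. -/
noncomputable def doubledSubspace {K : Type v} [Field K] {G : Type u} [Group G]
    (D : DoublingDatum G) (A : Submodule K (MonoidAlgebra K G)) :
    Submodule K (MonoidAlgebra K (DoubledLoop D)) :=
  A.map (groupAlgToLoopAlg K D) ⊔
    A.map ((LinearMap.mulRight K
      (MonoidAlgebra.single (DoubledLoop.inGu 1) 1 : MonoidAlgebra K (DoubledLoop D))).comp
        (groupAlgToLoopAlg K D))

/-! ### The groups of the classes `𝒟₁, …, 𝒟₅` and the loops of the classes `ℒ₁, …, ℒ₅` -/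

/-- The generators `x, y, t₁, …, t_{k+1}`; here `t i` stands for `t_{i+1}`. -/
inductive RAGen (k : ℕ) : Type
  | x : RAGen k
  | y : RAGen k
  | t (i : Fin (k + 1)) : RAGen k

/-- The relators for: all `t i` are central, `(t i) ^ 2 ^ (m i) = 1`, the commutator
`(x, y) = x⁻¹y⁻¹xy` is `s = t₁ ^ 2 ^ (m₁ - 1)`, `x² = p` and `y² = q`. -/
inductive RARelator (k : ℕ) (m : Fin (k + 1) → ℕ) (p q : FreeGroup (RAGen k)) :
    FreeGroup (RAGen k) → Prop
  | central (i : Fin (k + 1)) (g : RAGen k) :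
      RARelator k m p q
        ((FreeGroup.of (RAGen.t i))⁻¹ * (FreeGroup.of g)⁻¹ * FreeGroup.of (RAGen.t i) *
          FreeGroup.of g)
  | order (i : Fin (k + 1)) : RARelator k m p q (FreeGroup.of (RAGen.t i) ^ 2 ^ m i)
  | comm : RARelator k m p q
      ((FreeGroup.of RAGen.x)⁻¹ * (FreeGroup.of RAGen.y)⁻¹ * FreeGroup.of RAGen.x *
        FreeGroup.of RAGen.y * (FreeGroup.of (RAGen.t 0) ^ 2 ^ (m 0 - 1))⁻¹)
  | sq_x : RARelator k m p q (FreeGroup.of RAGen.x ^ 2 * p⁻¹)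
  | sq_y : RARelator k m p q (FreeGroup.of RAGen.y ^ 2 * q⁻¹)

/-- The group with the generators and relators above. -/
abbrev RAGroup (k : ℕ) (m : Fin (k + 1) → ℕ) (p q : FreeGroup (RAGen k)) : Type :=
  PresentedGroup {r | RARelator k m p q r}

section Classes

variable {G : Type u} [Group G] (D : DoublingDatum G)

/-- `G = ⟨x, y, t₁, …, t_{k+1}⟩` with `x² = p`, `y² = q`, and all the `m i` are positive, and
`g₀` is the element of `G` given by the word `r`. -/
def IsOfRAType (k : ℕ) (p q r : FreeGroup (RAGen k)) : Prop :=
  ∃ m : Fin (k + 1) → ℕ, (∀ i, 1 ≤ m i) ∧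
    ∃ φ : RAGroup k m p q ≃* G, D.g₀ = φ (PresentedGroup.mk {r | RARelator k m p q r} r)

/-- `ℒ₁`: `x² = 1`, `y² = 1`, `g₀ = 1`. -/
def InClassL1 : Prop := IsOfRAType D 0 1 1 1

/-- `ℒ₂`: `x² = t₁`, `y² = t₁`, `g₀ = t₁`. -/
def InClassL2 : Prop :=
  IsOfRAType D 0 (FreeGroup.of (RAGen.t 0)) (FreeGroup.of (RAGen.t 0)) (FreeGroup.of (RAGen.t 0))

/-- `ℒ₃`: `x² = 1`, `y² = t₂`, `g₀ = 1`. -/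
def InClassL3 : Prop := IsOfRAType D 1 1 (FreeGroup.of (RAGen.t 1)) 1

/-- `ℒ₄`: `x² = t₁`, `y² = t₂`, `g₀ = t₁`. -/
def InClassL4 : Prop :=
  IsOfRAType D 1 (FreeGroup.of (RAGen.t 0)) (FreeGroup.of (RAGen.t 1)) (FreeGroup.of (RAGen.t 0))

/-- `ℒ₅`: `x² = t₂`, `y² = t₃`, `g₀ = 1`. -/
def InClassL5 : Prop :=
  IsOfRAType D 2 (FreeGroup.of (RAGen.t 1)) (FreeGroup.of (RAGen.t 2)) 1

end Classes

/-! The loop algebra `KL` is the Cayley–Dickson double of `KG`: extended linearly, the involution of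
`G` becomes an involution `σ` of `KG`, and the loop product becomes the doubling formula with `u² =
g₀` (`isDoubling_loopAlgEquiv`). Everything rests on one fact: the elements fixed by `σ` are exactly
the centre of `KG` (`IsRALoop.isCentralInvolution`). Linearising the left alternative law on basis
elements gives `{gk, g*k} = {kg, kg*}`, so each `a + σ a` is central and each noncentral `g` is
conjugate to `g*`.

The unit of a summand `A` of `KG` is central, hence fixed by `σ`, so `σ` restricts to `A` and fixes
exactly its centre `F`. If `A` is commutative, it is a field on which `σ` is trivial. The double is
then `F[u]/(u² - d)`, where `d` is the component of `g₀` in `A`: two copies of `F` if `d` is a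
square in `F`, otherwise a quadratic extension field. If `A` is not commutative, skew elements have
scalar squares and scalar anticommutators. Orthogonalisation with respect to this form produces `i,
j` with `1, i, j, ij` a basis, so `A` is a quaternion algebra and `σ` its conjugation
(`IsStandardInvolution.exists_quaternion`); the double is then a Cayley algebra by definition.

In the five classes `g₀ = g²` for some `g` in `G`, so `d` is a square in every field summand and
each such summand contributes two fields. -/

/-! ### Simple rings with an involution whose fixed points are the centre -/

/-- A two-sided ideal containing a right-invertible element contains `1`. -/
theorem TwoSidedIdeal.one_mem_of_mul_eq_one {R : Type v} [Ring R] (J : TwoSidedIdeal R) {x y : R}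
    (hx : x ∈ J) (hxy : x * y = 1) : (1 : R) ∈ J :=
  hxy ▸ J.mul_mem_right x y hx

/-- Averaging over `i` and then over `j` removes the imaginary part: `αx + ixi` kills the `j` and
`ij` components, and repeating this with `j` and `β` leaves `4αβ · re x`. So an ideal containing an
element with nonzero real part is everything. A nonzero `x` yields such an element because the form
`re (x * y)` is nondegenerate. -/
theorem QuaternionAlgebra.isSimpleRing {F : Type u} [Field F] {α β : F} (h2 : (2 : F) ≠ 0)
    (hα : α ≠ 0) (hβ : β ≠ 0) : IsSimpleRing (QuaternionAlgebra F α 0 β) := by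
  have key : ∀ (J : TwoSidedIdeal (QuaternionAlgebra F α 0 β)) (x : QuaternionAlgebra F α 0 β),
      x ∈ J → x.re ≠ 0 → (1 : QuaternionAlgebra F α 0 β) ∈ J := by
    intro J x hx h0
    let i : QuaternionAlgebra F α 0 β := ⟨0, 1, 0, 0⟩
    let j : QuaternionAlgebra F α 0 β := ⟨0, 0, 1, 0⟩
    have h4 : 4 * α * β * x.re ≠ 0 := by
      rw [show (4 : F) = 2 * 2 by norm_num]
      exact mul_ne_zero (mul_ne_zero (mul_ne_zero (mul_ne_zero h2 h2) hα) hβ) h0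
    have hy : (⟨α, 0, 0, 0⟩ * x + i * x * i : QuaternionAlgebra F α 0 β) ∈ J :=
      J.add_mem (J.mul_mem_left _ _ hx) (J.mul_mem_right _ _ (J.mul_mem_left _ _ hx))
    have hz : (⟨β, 0, 0, 0⟩ * (⟨α, 0, 0, 0⟩ * x + i * x * i) +
        j * (⟨α, 0, 0, 0⟩ * x + i * x * i) * j : QuaternionAlgebra F α 0 β) ∈ J :=
      J.add_mem (J.mul_mem_left _ _ hy) (J.mul_mem_right _ _ (J.mul_mem_left _ _ hy))
    have he : (⟨β, 0, 0, 0⟩ * (⟨α, 0, 0, 0⟩ * x + i * x * i) +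
        j * (⟨α, 0, 0, 0⟩ * x + i * x * i) * j : QuaternionAlgebra F α 0 β) =
        ⟨4 * α * β * x.re, 0, 0, 0⟩ := by
      ext <;> simp [i, j] <;> ring
    rw [he] at hz
    refine TwoSidedIdeal.one_mem_of_mul_eq_one J (y := ⟨(4 * α * β * x.re)⁻¹, 0, 0, 0⟩) hz ?_
    generalize 4 * α * β * x.re = v at h4
    ext <;> simp [h4]
  refine IsSimpleRing.of_eq_bot_or_eq_top fun J => or_iff_not_imp_left.2 fun hJ => ?_
  rw [← TwoSidedIdeal.one_mem_iff]
  obtain ⟨x, hx, hx0⟩ := SetLike.exists_of_lt (bot_lt_iff_ne_bot.2 hJ)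
  by_contra h1
  have H : ∀ y : QuaternionAlgebra F α 0 β, (x * y).re = 0 := fun y => by
    by_contra h0
    exact h1 (key J _ (J.mul_mem_right _ _ hx) h0)
  refine hx0 ((TwoSidedIdeal.mem_bot _).2 ?_)
  have e0 := H ⟨1, 0, 0, 0⟩
  have e1 := H ⟨0, 1, 0, 0⟩
  have e2 := H ⟨0, 0, 1, 0⟩
  have e3 := H ⟨0, 0, 0, 1⟩
  simp [hα, hβ] at e0 e1 e2 e3
  ext <;> simp [e0, e1, e2, e3]

section LocalTheory

variable {F : Type u} {T : Type v} [Field F] [Ring T] [Algebra F T]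

/-- A simple ring is prime: the `x` with `aTx = 0` form a two-sided ideal, which contains `a`. -/
theorem eq_zero_of_forall_mul_mul_eq_zero [IsSimpleRing T] {a : T} (h : ∀ t, a * t * a = 0) :
    a = 0 := by
  by_contra ha
  let J : TwoSidedIdeal T := TwoSidedIdeal.mk' {x | ∀ t, a * t * x = 0} (by simp)
    (fun hx hy t => by rw [mul_add, hx t, hy t, add_zero])
    (fun hx t => by rw [mul_neg, hx t, neg_zero])
    (fun {x y} hy t => by rw [← mul_assoc, mul_assoc a t x, hy])
    (fun {x y} hx t => by rw [← mul_assoc, hx t, zero_mul])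
  have h1 : (1 : T) ∈ J := IsSimpleRing.one_mem_of_ne_zero_mem J ha
    ((TwoSidedIdeal.mem_mk' ..).2 h)
  have h2 : ∀ t, a * t * 1 = 0 := (TwoSidedIdeal.mem_mk' ..).1 h1
  exact ha (by simpa using h2 1)

/-- Moving `r` and `s` across `p` reverses their order twice, so `rsp = srp`: commutators annihilate
`p`. The ideal of all `x` with `xTp = 0` thus contains a nonzero commutator, hence `1`. This is what
makes the double of a noncommutative ideal simple. -/
theorem eq_zero_of_forall_mul_eq_mul_star [IsSimpleRing T] {σ : T →ₗ[F] T} {p x y : T}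
    (hxy : x * y ≠ y * x) (h : ∀ r, r * p = p * σ r) (hσ : ∀ a b, σ (a * b) = σ b * σ a) :
    p = 0 := by
  let J : TwoSidedIdeal T := TwoSidedIdeal.mk' {x | ∀ t, x * t * p = 0} (by simp)
    (fun hx hy t => by rw [add_mul, add_mul, hx t, hy t, add_zero])
    (fun hx t => by rw [neg_mul, neg_mul, hx t, neg_zero])
    (fun {x y} hy t => by rw [mul_assoc, mul_assoc, ← mul_assoc y, hy, mul_zero])
    (fun {x y} hx t => by rw [mul_assoc x, hx])
  have hc : ∀ r s, r * s * p = s * r * p := fun r s => by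
    rw [h, hσ, ← mul_assoc, ← h s, mul_assoc, ← h r, mul_assoc]
  have h1 : (1 : T) ∈ J := IsSimpleRing.one_mem_of_ne_zero_mem J (sub_ne_zero.2 hxy) <|
    (TwoSidedIdeal.mem_mk' ..).2 fun t => by
      rw [mul_assoc, h t, ← mul_assoc, sub_mul, hc x y, sub_self, zero_mul]
  have h2 : ∀ t, 1 * t * p = 0 := (TwoSidedIdeal.mem_mk' ..).1 h1
  simpa using h2 1

variable {σ : T →ₗ[F] T}

/-- An `F`-linear involution of `T` whose fixed points are exactly `F`. -/
structure IsStandardInvolution (σ : T →ₗ[F] T) : Prop where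
  mul : ∀ a b, σ (a * b) = σ b * σ a
  invol : ∀ a, σ (σ a) = a
  fixed : ∀ a, σ a = a ↔ a ∈ Set.range (algebraMap F T)

namespace IsStandardInvolution

theorem algebraMap (hσ : IsStandardInvolution σ) (z : F) :
    σ (algebraMap F T z) = algebraMap F T z := (hσ.fixed _).2 ⟨z, rfl⟩

/-- Skew elements have scalar anticommutators. -/
theorem exists_anticomm (hσ : IsStandardInvolution σ) {a b : T} (ha : σ a = -a) (hb : σ b = -b) :
    ∃ z : F, a * b + b * a = z • (1 : T) := by
  obtain ⟨z, hz⟩ := (hσ.fixed (a * b + b * a)).1 (by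
    rw [map_add, hσ.mul, hσ.mul, ha, hb]; noncomm_ring)
  exact ⟨z, by rw [← hz, Algebra.algebraMap_eq_smul_one]⟩

theorem exists_sq (hσ : IsStandardInvolution σ) {a : T} (ha : σ a = -a) :
    ∃ z : F, a * a = z • (1 : T) := by
  obtain ⟨z, hz⟩ := (hσ.fixed (a * a)).1 (by rw [hσ.mul, ha]; noncomm_ring)
  exact ⟨z, by rw [← hz, Algebra.algebraMap_eq_smul_one]⟩

theorem exists_decomp (hσ : IsStandardInvolution σ) (h2 : (2 : F) ≠ 0) (a : T) :
    ∃ (z : F) (b : T), σ b = -b ∧ a = z • (1 : T) + b := by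
  obtain ⟨z, hz⟩ := (hσ.fixed (a + σ a)).1 (by rw [map_add, hσ.invol, add_comm])
  rw [Algebra.algebraMap_eq_smul_one] at hz
  have hs : σ a = z • (1 : T) - a := by rw [hz]; abel
  refine ⟨z / 2, a - (z / 2) • (1 : T), ?_, by abel⟩
  have h1 : σ 1 = 1 := by simpa using hσ.algebraMap 1
  have : z = z / 2 + z / 2 := by field_simp; ring
  rw [map_sub, map_smul, h1, hs]
  nth_rw 1 [this]
  rw [add_smul]; abel

/-- One Gram–Schmidt step for the scalar-valued form `ab + ba` on skew elements. -/
theorem exists_anticomm_sub (hσ : IsStandardInvolution σ) (h2 : (2 : F) ≠ 0) {a c : T} {α : F}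
    (ha : σ a = -a) (hc : σ c = -c) (hα : α ≠ 0) (haa : a * a = α • (1 : T)) :
    ∃ w : F, σ (c - w • a) = -(c - w • a) ∧ a * (c - w • a) = -((c - w • a) * a) := by
  obtain ⟨w, hw⟩ := hσ.exists_anticomm ha hc
  refine ⟨w / (2 * α), by rw [map_sub, map_smul, ha, hc, smul_neg]; abel, ?_⟩
  rw [eq_neg_iff_add_eq_zero, mul_sub, sub_mul, mul_smul_comm, smul_mul_assoc, haa,
    sub_add_sub_comm, hw, smul_smul, ← add_smul, ← sub_smul]
  convert zero_smul F (1 : T)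
  field_simp; ring

/-- If there is a nonzero skew element, then some skew element has nonzero square. -/
theorem exists_skew_sq_ne_zero [IsSimpleRing T] (hσ : IsStandardInvolution σ) (h2 : (2 : F) ≠ 0)
    {b : T} (hb : σ b = -b) (hb0 : b ≠ 0) :
    ∃ (a : T) (z : F), σ a = -a ∧ z ≠ 0 ∧ a * a = z • (1 : T) := by
  by_contra! H
  have hsq : ∀ a, σ a = -a → a * a = 0 := fun a ha => by
    obtain ⟨z, hz⟩ := hσ.exists_sq ha
    by_cases h0 : z = 0
    · rw [hz, h0, zero_smul]
    · exact absurd hz (H a z ha h0)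
  -- If all skew squares vanish, polarisation makes `b` anticommute with every skew `c`, so `bTb =
  -- 0`, against primeness.
  refine hb0 (eq_zero_of_forall_mul_mul_eq_zero fun t => ?_)
  obtain ⟨z, c, hc, rfl⟩ := hσ.exists_decomp h2 t
  have h3 := hsq (b + c) (by rw [map_add, hb, hc]; abel)
  have h4 : b * c = -(c * b) := by
    rw [add_mul, mul_add, mul_add, hsq b hb, hsq c hc] at h3
    exact eq_neg_of_add_eq_zero_left (by simpa using h3)
  rw [mul_add, add_mul, h4, neg_mul, mul_assoc c, hsq b hb]
  simp [hsq b hb]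

/-- If a nonzero skew element anticommutes with the skew element `i` of nonzero square, then so does
one with nonzero square. -/
theorem exists_anticomm_sq_ne_zero [IsSimpleRing T] (hσ : IsStandardInvolution σ)
    (h2 : (2 : F) ≠ 0) {i : T} {α : F} (hi : σ i = -i) (hα : α ≠ 0) (hii : i * i = α • (1 : T))
    {b : T} (hb : σ b = -b) (hib : i * b = -(b * i)) (hb0 : b ≠ 0) :
    ∃ (a : T) (z : F), σ a = -a ∧ i * a = -(a * i) ∧ z ≠ 0 ∧ a * a = z • (1 : T) := by
  by_contra! H
  have hsq : ∀ a, σ a = -a → i * a = -(a * i) → a * a = 0 := fun a ha hia => by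
    obtain ⟨z, hz⟩ := hσ.exists_sq ha
    by_cases h0 : z = 0
    · rw [hz, h0, zero_smul]
    · exact absurd hz (H a z ha hia h0)
  -- Again `bTb = 0`: split `t` into a scalar, a multiple of `i` and a skew `d` anticommuting with
  -- `i`. Polarisation handles `d`, and `bib = -b²i = 0`.
  refine hb0 (eq_zero_of_forall_mul_mul_eq_zero fun t => ?_)
  obtain ⟨z, c, hc, rfl⟩ := hσ.exists_decomp h2 t
  obtain ⟨w, hd1, hd2⟩ := hσ.exists_anticomm_sub h2 hi hc hα hii
  obtain ⟨d, hd⟩ : ∃ d, d = c - w • i := ⟨_, rfl⟩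
  rw [← hd] at hd1 hd2
  have hc' : c = d + w • i := by rw [hd]; abel
  have hbb := hsq b hb hib
  have h3 := hsq (b + d) (by rw [map_add, hb, hd1]; abel) (by rw [mul_add, add_mul, hib, hd2]; abel)
  have h4 : b * d = -(d * b) := by
    rw [add_mul, mul_add, mul_add, hbb, hsq d hd1 hd2] at h3
    exact eq_neg_of_add_eq_zero_left (by simpa using h3)
  have h5 : b * i * b = 0 := by rw [mul_assoc, hib, mul_neg, ← mul_assoc, hbb, zero_mul, neg_zero]
  rw [hc', mul_add, mul_add, add_mul, add_mul, h4, neg_mul, mul_assoc d, hbb, mul_smul_comm,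
    mul_smul_comm, smul_mul_assoc, smul_mul_assoc, h5]
  simp [hbb]

theorem exists_quaternion [IsSimpleRing T] (hσ : IsStandardInvolution σ) (h2 : (2 : F) ≠ 0)
    (hne : ∃ x y : T, x * y ≠ y * x) :
    ∃ (α β : F), α ≠ 0 ∧ β ≠ 0 ∧ ∃ f : QuaternionAlgebra F α 0 β →ₐ[F] T,
      Function.Bijective f ∧ ∀ q, σ (f q) = f (star q) := by
  have h20 : ∀ t : T, t + t = 0 → t = 0 := fun t ht => by
    rw [← two_smul F] at ht
    exact (smul_eq_zero.1 ht).resolve_left h2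
  have h1 : σ 1 = 1 := by simpa using hσ.algebraMap 1
  obtain ⟨x, y, hxy⟩ := hne
  obtain ⟨i, α, hi, hα, hii⟩ : ∃ (i : T) (α : F), σ i = -i ∧ α ≠ 0 ∧ i * i = α • (1 : T) := by
    obtain ⟨z, b, hb, rfl⟩ := hσ.exists_decomp h2 x
    refine hσ.exists_skew_sq_ne_zero h2 hb fun h => hxy ?_
    simp [h]
  obtain ⟨j, β, hj, hij, hβ, hjj⟩ : ∃ (j : T) (β : F), σ j = -j ∧ i * j = -(j * i) ∧ β ≠ 0 ∧
      j * j = β • (1 : T) := by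
    by_cases H : ∃ b, σ b = -b ∧ i * b = -(b * i) ∧ b ≠ 0
    · obtain ⟨b, hb, hib, hb0⟩ := H
      exact hσ.exists_anticomm_sq_ne_zero h2 hi hα hii hb hib hb0
    -- If no nonzero skew element is orthogonal to `i`, then `T = F + Fi` is commutative.
    · push Not at H
      have key : ∀ t : T, ∃ z w : F, t = z • (1 : T) + w • i := fun t => by
        obtain ⟨z, c, hc, rfl⟩ := hσ.exists_decomp h2 t
        obtain ⟨w, h3, h4⟩ := hσ.exists_anticomm_sub h2 hi hc hα hii
        exact ⟨z, w, by rw [sub_eq_zero.1 (H _ h3 h4)]⟩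
      obtain ⟨z, w, rfl⟩ := key x
      obtain ⟨z', w', rfl⟩ := key y
      refine absurd ?_ hxy
      simp only [add_mul, mul_add, smul_mul_assoc, mul_smul_comm, one_mul, mul_one, hii]
      module
  have hji : j * i = -(i * j) := by rw [hij, neg_neg]
  let Q : QuaternionAlgebra.Basis T α 0 β :=
    { i := i, j := j, k := i * j, i_mul_i := by rw [hii]; simp, j_mul_j := hjj, i_mul_j := rfl,
      j_mul_i := by rw [hji]; simp }
  have hk : σ (i * j) = -(i * j) := by rw [hσ.mul, hi, hj, neg_mul_neg, hji]
  have hf : ∀ q, Q.liftHom q = q.re • (1 : T) + q.imI • i + q.imJ • j + q.imK • (i * j) :=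
    fun q => by
      simp [QuaternionAlgebra.Basis.liftHom, QuaternionAlgebra.Basis.lift, Q,
        Algebra.algebraMap_eq_smul_one]
  refine ⟨α, β, hα, hβ, Q.liftHom, ⟨?_, ?_⟩, ?_⟩
  · have := QuaternionAlgebra.isSimpleRing h2 hα hβ
    exact Q.liftHom.toRingHom.injective
  · intro t
    obtain ⟨z, c, hc, rfl⟩ := hσ.exists_decomp h2 t
    have hkk : (i * j) * (i * j) = (-(α * β)) • (1 : T) := by
      rw [mul_assoc, ← mul_assoc j, hji, neg_mul, mul_neg, mul_assoc i j j, hjj, mul_smul_comm,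
        mul_one, mul_smul_comm, hii, smul_smul, ← neg_smul, mul_comm]
    have hik : i * (i * j) = -(i * j * i) := by rw [mul_assoc, hji, mul_neg, neg_neg]
    have hjk : j * (i * j) = -(i * j * j) := by rw [← mul_assoc, hji, neg_mul]
    obtain ⟨w₁, s₁, a₁⟩ := hσ.exists_anticomm_sub h2 hi hc hα hii
    obtain ⟨w₂, s₂, a₂⟩ := hσ.exists_anticomm_sub h2 hj s₁ hβ hjj
    obtain ⟨w₃, s₃, a₃⟩ := hσ.exists_anticomm_sub h2 hk s₂
      (neg_ne_zero.2 (mul_ne_zero hα hβ)) hkk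
    -- The remainder `d` after projecting off `i`, `j`, `ij` anticommutes with all three. But
    -- anticommuting with `i` and `j` forces commuting with `ij`, so `2d(ij) = 0` and `d = 0`. Hence
    -- the four elements span.
    obtain ⟨d, hd⟩ : ∃ d, d = c - w₁ • i - w₂ • j - w₃ • (i * j) := ⟨_, rfl⟩
    rw [← hd] at a₃ s₃
    have b₁ : i * d = -(d * i) := by
      have : i * d = i * (c - w₁ • i) - w₂ • (i * j) - w₃ • (i * (i * j)) := by
        rw [hd]; simp only [mul_sub, mul_smul_comm]
      rw [this, a₁, hik, hd]; simp only [sub_mul, smul_mul_assoc, hji]; module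
    have b₂ : j * d = -(d * j) := by
      have : j * d = j * (c - w₁ • i - w₂ • j) - w₃ • (j * (i * j)) := by
        rw [hd]; simp only [mul_sub, mul_smul_comm]
      rw [this, a₂, hjk, hd]; simp only [sub_mul, smul_mul_assoc]; module
    have b₃ : i * j * d = d * (i * j) := by
      rw [mul_assoc, b₂, mul_neg, ← mul_assoc, b₁, neg_mul, neg_neg, mul_assoc]
    have b₄ : d * (i * j) = 0 := h20 _ (by nth_rw 1 [← b₃, a₃]; abel)
    have b₅ : d = 0 := by
      have : d * (i * j * (i * j)) = 0 := by rw [← mul_assoc, b₄, zero_mul]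
      rw [hkk, mul_smul_comm, mul_one] at this
      exact (smul_eq_zero.1 this).resolve_left (neg_ne_zero.2 (mul_ne_zero hα hβ))
    refine ⟨⟨z, w₁, w₂, w₃⟩, ?_⟩
    rw [hf]
    have : c = w₁ • i + w₂ • j + w₃ • (i * j) := by
      rw [← sub_eq_zero, ← b₅, hd]; abel
    rw [this]; abel
  · intro q
    rw [hf, hf]
    simp only [map_add, map_smul, h1, hi, hj, hk, QuaternionAlgebra.re_star, QuaternionAlgebra.imI_star,
      QuaternionAlgebra.imJ_star, QuaternionAlgebra.imK_star]
    module
end IsStandardInvolution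
end LocalTheory

theorem IsCopyOf.of_linearMap {K : Type u} [Field K] {R : Type v} [NonUnitalNonAssocRing R]
    [Module K R] {I : Submodule K R} {C : Type w} [NonUnitalNonAssocRing C] [Module K C]
    (f : C →ₗ[K] R) (hmul : ∀ x y, f (x * y) = f x * f y) (hinj : ∀ x, f x = 0 → x = 0)
    (hmem : ∀ x, f x ∈ I) (hsurj : ∀ y ∈ I, ∃ x, f x = y) : IsCopyOf I C :=
  ⟨{ f with map_zero' := map_zero f, map_mul' := hmul }, (injective_iff_map_eq_zero f).2 hinj,
    Set.eq_of_subset_of_subset (by rintro _ ⟨x, rfl⟩; exact hmem x) hsurj⟩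

theorem exists_center_field (K : Type u) [Field K] (T : Type v) [Ring T] [IsSimpleRing T]
    [Algebra K T] : ∃ (F : Type v) (_ : Field F) (_ : Algebra K F) (_ : Algebra F T)
      (_ : IsScalarTower K F T), ∀ x : T, (∀ y, x * y = y * x) ↔ x ∈ Set.range (algebraMap F T) := by
  have h : IsField (Subalgebra.center K T) := IsSimpleRing.isField_center T
  let a₁ : Algebra K (Subalgebra.center K T) := inferInstance
  let a₂ : Algebra (Subalgebra.center K T) T :=
    (Subalgebra.center K T).val.toRingHom.toAlgebra' fun c x =>
      (Subalgebra.mem_center_iff.1 c.2 x).symm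
  refine ⟨Subalgebra.center K T, h.toField, a₁, a₂,
    IsScalarTower.of_algebraMap_eq' (R := K) (S := Subalgebra.center K T) (A := T) rfl, fun x => ⟨fun hx => ?_, ?_⟩⟩
  · exact ⟨⟨x, Subalgebra.mem_center_iff.2 fun b => (hx b).symm⟩, rfl⟩
  · rintro ⟨z, rfl⟩ y
    exact @Algebra.commutes (Subalgebra.center K T) T _ _ a₂ z y

/-! ### Ideals with a unit element -/

/-- `A` is a two-sided ideal, and `e` is a unit element of it. -/
structure IsUnitalIdeal {K : Type u} [Field K] {R : Type v} [Ring R] [Algebra K R]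
    (A : Submodule K R) (e : R) : Prop where
  ideal : IsAlgIdeal A
  mem : e ∈ A
  mul_left : ∀ x ∈ A, e * x = x
  mul_right : ∀ x ∈ A, x * e = x

namespace IsUnitalIdeal

variable {K : Type u} [Field K] {R : Type v} [Ring R] [Algebra K R] {A : Submodule K R} {e : R}

/-- Both sides equal `ere`. -/
theorem comm (h : IsUnitalIdeal A e) (r : R) : e * r = r * e := by
  rw [← h.mul_right _ (h.ideal r e h.mem).2, mul_assoc, h.mul_left _ (h.ideal r e h.mem).1]

/-- The multiplicatively closed subspace underlying a unital ideal. -/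
def toNonUnitalSubalgebra (h : IsUnitalIdeal A e) : NonUnitalSubalgebra K R :=
  { A with mul_mem' := fun {a b} _ hb => (h.ideal a b hb).1 }

/-- A unital ideal as a ring of its own. -/
def Carrier (h : IsUnitalIdeal A e) : Type v := h.toNonUnitalSubalgebra

instance (h : IsUnitalIdeal A e) : Ring h.Carrier :=
  { (inferInstance : NonUnitalRing h.toNonUnitalSubalgebra) with
    one := ⟨e, h.mem⟩
    one_mul := fun a => Subtype.ext (h.mul_left a.1 a.2)
    mul_one := fun a => Subtype.ext (h.mul_right a.1 a.2) }

instance (h : IsUnitalIdeal A e) : Module K h.Carrier :=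
  inferInstanceAs (Module K h.toNonUnitalSubalgebra)

instance (h : IsUnitalIdeal A e) : Algebra K h.Carrier :=
  Algebra.ofModule (fun r x y => Subtype.ext (smul_mul_assoc r x.1 y.1))
    (fun r x y => Subtype.ext (mul_smul_comm r x.1 y.1))

/-- The inclusion of a unital ideal. -/
def val (h : IsUnitalIdeal A e) : h.Carrier →ₗ[K] R := A.subtype

/-- The element of the ring `h.Carrier` given by an element of the ideal. -/
def elem (h : IsUnitalIdeal A e) (x : R) (hx : x ∈ A) : h.Carrier := ⟨x, hx⟩

variable (h : IsUnitalIdeal A e)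

@[simp] theorem val_elem (x : R) (hx : x ∈ A) : h.val (h.elem x hx) = x := rfl
@[simp] theorem val_mul (x y : h.Carrier) : h.val (x * y) = h.val x * h.val y := rfl
@[simp] theorem val_one : h.val 1 = e := rfl
theorem val_mem (x : h.Carrier) : h.val x ∈ A := x.2
theorem val_injective : Function.Injective h.val := Subtype.val_injective

theorem isSimpleRing (hs : IsSimpleAlg A) : IsSimpleRing h.Carrier := by
  obtain ⟨-, ⟨x, hx, y, hy, hxy⟩, hA⟩ := hs
  have : Nontrivial h.Carrier := ⟨h.elem x hx, 0, fun h0 => hxy (by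
    have := congrArg h.val h0
    rw [val_elem, map_zero] at this
    rw [this, zero_mul])⟩
  refine IsSimpleRing.of_eq_bot_or_eq_top fun J => ?_
  let J' : Submodule K R :=
    { carrier := h.val '' J
      zero_mem' := ⟨0, J.zero_mem, map_zero _⟩
      add_mem' := by
        rintro _ _ ⟨a, ha, rfl⟩ ⟨b, hb, rfl⟩
        exact ⟨a + b, J.add_mem ha hb, map_add _ _ _⟩
      smul_mem' := by
        rintro k _ ⟨a, ha, rfl⟩
        refine ⟨k • a, ?_, map_smul _ _ _⟩
        -- Ring ideals are automatically `K`-subspaces, since scalars act through multiples of the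
        -- unit.
        have := J.mul_mem_left (k • 1) a ha
        rwa [smul_mul_assoc, one_mul] at this }
  rcases hA J' (by rintro _ ⟨a, -, rfl⟩; exact h.val_mem a) (by
    rintro a ha _ ⟨b, hb, rfl⟩
    exact ⟨⟨h.elem a ha * b, J.mul_mem_left _ _ hb, rfl⟩,
      ⟨b * h.elem a ha, J.mul_mem_right _ _ hb, rfl⟩⟩) with h0 | h1
  · left
    refine eq_bot_iff.2 fun a ha => ?_
    have : h.val a ∈ J' := ⟨a, ha, rfl⟩
    rw [h0, Submodule.mem_bot] at this
    exact (TwoSidedIdeal.mem_bot _).2 (h.val_injective (by rw [this, map_zero]))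
  · right
    rw [← TwoSidedIdeal.one_mem_iff]
    obtain ⟨a, ha, hae⟩ : e ∈ J' := h1 ▸ h.mem
    rwa [← h.val_injective (hae.trans h.val_one.symm)]

end IsUnitalIdeal

theorem IsCopyOf.isSimpleAlg {K : Type u} [Field K] {R : Type v} [NonUnitalNonAssocRing R]
    [Module K R] {I : Submodule K R} {C : Type w} [Ring C] [Algebra K C] [IsSimpleRing C]
    (h : IsCopyOf I C) : IsSimpleAlg I := by
  obtain ⟨f, hf, hr⟩ := h
  have hI : ∀ x, x ∈ I ↔ ∃ a, f a = x := fun x => by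
    rw [← SetLike.mem_coe, ← hr]; rfl
  refine ⟨fun x hx y hy => ?_, ⟨f 1, (hI _).2 ⟨1, rfl⟩, f 1, (hI _).2 ⟨1, rfl⟩, ?_⟩, ?_⟩
  · obtain ⟨a, rfl⟩ := (hI _).1 hx
    obtain ⟨b, rfl⟩ := (hI _).1 hy
    exact (hI _).2 ⟨a * b, map_mul f a b⟩
  · rw [← map_mul, mul_one]
    exact fun h => one_ne_zero (hf (h.trans (map_zero f).symm))
  · intro J hJ hJI
    let J' : TwoSidedIdeal C := TwoSidedIdeal.mk' {x | f x ∈ J} (by simp)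
      (fun hx hy => by simpa using J.add_mem hx hy) (fun hx => by simpa using hx)
      (fun {x y} hy => by simpa using (hJI (f x) ((hI _).2 ⟨x, rfl⟩) _ hy).1)
      (fun {x y} hx => by simpa using (hJI (f y) ((hI _).2 ⟨y, rfl⟩) _ hx).2)
    have hJ' : ∀ x, x ∈ J' ↔ f x ∈ J := fun x => TwoSidedIdeal.mem_mk' ..
    rcases eq_bot_or_eq_top J' with h0 | h1
    · left
      refine eq_bot_iff.2 fun y hy => ?_
      obtain ⟨x, rfl⟩ := (hI _).1 (hJ hy)
      have := (hJ' x).2 hy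
      rw [h0, TwoSidedIdeal.mem_bot] at this
      simp [this]
    · right
      refine le_antisymm hJ fun y hy => ?_
      obtain ⟨x, rfl⟩ := (hI _).1 hy
      exact (hJ' x).1 (h1 ▸ TwoSidedIdeal.mem_top _)

theorem IsFieldAlg.isSimpleAlg {K : Type u} [Field K] {R : Type v} [NonUnitalNonAssocRing R]
    [Module K R] {I : Submodule K R} (h : IsFieldAlg I) : IsSimpleAlg I := by
  obtain ⟨F, _, _, h⟩ := h
  exact h.isSimpleAlg

theorem IsQuaternionAlg.isSimpleAlg {K : Type u} [Field K] {R : Type v} [NonUnitalNonAssocRing R]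
    [Module K R] {I : Submodule K R} (h : IsQuaternionAlg I) : IsSimpleAlg I := by
  obtain ⟨F, _, _, a, b, h2, ha, hb, h⟩ := h
  have := QuaternionAlgebra.isSimpleRing h2 ha hb
  exact h.isSimpleAlg

theorem IsFieldAlg.mul_comm {K : Type u} [Field K] {R : Type v} [NonUnitalNonAssocRing R]
    [Module K R] {I : Submodule K R} (h : IsFieldAlg I) : ∀ x ∈ I, ∀ y ∈ I, x * y = y * x := by
  obtain ⟨F, _, _, f, -, hr⟩ := h
  intro x hx y hy
  rw [← SetLike.mem_coe, ← hr] at hx hy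
  obtain ⟨a, rfl⟩ := hx
  obtain ⟨b, rfl⟩ := hy
  rw [← map_mul, ← map_mul, _root_.mul_comm]

theorem IsQuaternionAlg.exists_mul_ne {K : Type u} [Field K] {R : Type v}
    [NonUnitalNonAssocRing R] [Module K R] {I : Submodule K R} (h : IsQuaternionAlg I) :
    ∃ x ∈ I, ∃ y ∈ I, x * y ≠ y * x := by
  obtain ⟨F, _, _, a, b, h2, ha, hb, f, hf, hr⟩ := h
  have hI : ∀ a, f a ∈ I := fun a => by rw [← SetLike.mem_coe, ← hr]; exact ⟨a, rfl⟩
  refine ⟨f ⟨0, 1, 0, 0⟩, hI _, f ⟨0, 0, 1, 0⟩, hI _, ?_⟩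
  rw [← map_mul, ← map_mul]
  intro H
  have := congrArg QuaternionAlgebra.imK (hf H)
  simp at this
  have h3 : (1 : F) + 1 = 0 := by
    nth_rw 2 [this]; ring
  exact h2 (by rw [← h3]; norm_num)

/-! ### Involutions fixing exactly the centre, and doubles of simple ideals -/

section Doubling

variable {K : Type u} [Field K] {R : Type v} [Ring R] [Algebra K R]

/-- A `K`-linear involution of `R` whose fixed points are exactly the central elements. -/
structure IsCentralInvolution (σ : R →ₗ[K] R) : Prop where
  mul : ∀ a b, σ (a * b) = σ b * σ a
  invol : ∀ a, σ (σ a) = a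
  fixed : ∀ a, σ a = a ↔ ∀ b, a * b = b * a

namespace IsUnitalIdeal

variable {A : Submodule K R} {e : R} {σ : R →ₗ[K] R} (h : IsUnitalIdeal A e)
include h

theorem star_unit (hσ : IsCentralInvolution σ) : σ e = e := (hσ.fixed e).2 h.comm

theorem star_mem (hσ : IsCentralInvolution σ) {x : R} (hx : x ∈ A) : σ x ∈ A := by
  rw [← h.mul_right x hx, hσ.mul, h.star_unit hσ]
  exact (h.ideal _ _ h.mem).2

/-- On `A`, multiplication by `r` agrees with multiplication by `er ∈ A`. So the centre of `A`
consists of central elements of `R`, which `σ` fixes. -/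
theorem central_of_comm_carrier {x : R} (hx : x ∈ A) (hc : ∀ y ∈ A, x * y = y * x) (r : R) :
    x * r = r * x := by
  have h1 := hc _ (h.ideal r e h.mem).2
  rwa [← mul_assoc, h.mul_right x hx, h.comm, mul_assoc, h.mul_left x hx] at h1

/-- The centre of a simple ideal with unit, and the involution induced on the ideal. -/
theorem exists_center_involution (hσ : IsCentralInvolution σ) (hs : IsSimpleAlg A) :
    ∃ (F : Type v) (_ : Field F) (_ : Algebra K F) (_ : Algebra F h.Carrier)
      (_ : IsScalarTower K F h.Carrier) (τ : h.Carrier →ₗ[F] h.Carrier),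
      IsStandardInvolution τ ∧ (∀ x, h.val (τ x) = σ (h.val x)) ∧
      ∀ x : h.Carrier, (∀ y, x * y = y * x) ↔ x ∈ Set.range (algebraMap F h.Carrier) := by
  have := h.isSimpleRing hs
  obtain ⟨F, _, _, _, _, hF⟩ := exists_center_field K h.Carrier
  have hcen : ∀ x : h.Carrier, σ (h.val x) = h.val x ↔ ∀ y, x * y = y * x := fun x => by
    rw [hσ.fixed]
    constructor
    · exact fun hx y => h.val_injective (hx (h.val y))
    · exact fun hx => h.central_of_comm_carrier (h.val_mem x)
        fun y hy => congrArg h.val (hx (h.elem y hy))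
  let τ : h.Carrier →ₗ[F] h.Carrier :=
    { toFun := fun x => h.elem (σ (h.val x)) (h.star_mem hσ (h.val_mem x))
      map_add' := fun x y => h.val_injective (by simp)
      -- Linearity over the centre: its elements are fixed by `σ`.
      map_smul' := fun z x => h.val_injective (by
        have hz := (hcen _).2 ((hF _).2 ⟨z, rfl⟩)
        have hz' := (hσ.fixed _).1 hz
        simp [Algebra.smul_def, hσ.mul, hz, hz']) }
  have hτ : ∀ x, h.val (τ x) = σ (h.val x) := fun x => rfl
  refine ⟨F, _, _, _, ‹_›, τ, ⟨?_, ?_, ?_⟩, hτ, hF⟩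
  · exact fun a b => h.val_injective (by simp [hτ, hσ.mul])
  · exact fun a => h.val_injective (by simp [hτ, hσ.invol])
  · intro a
    rw [← hF, ← hcen, ← hτ]
    exact h.val_injective.eq_iff.symm

end IsUnitalIdeal

variable {S : Type v} [NonUnitalNonAssocRing S] [Module K S]

/-- `Φ` identifies `S` with the Cayley–Dickson double `R + Ru`, where `u² = c`. -/
def IsDoubling (σ : R →ₗ[K] R) (c : R) (Φ : (R × R) ≃ₗ[K] S) : Prop :=
  ∀ p q r t, Φ (p, q) * Φ (r, t) = Φ (p * r + c * (σ t * q), t * p + q * σ r)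

/-- The subspace `A + Au` of a double `R + Ru`. -/
def doubled (Φ : (R × R) ≃ₗ[K] S) (A : Submodule K R) : Submodule K S :=
  (A.prod A).map Φ.toLinearMap

theorem mem_doubled {Φ : (R × R) ≃ₗ[K] S} {A : Submodule K R} {p q : R} :
    Φ (p, q) ∈ doubled Φ A ↔ p ∈ A ∧ q ∈ A := by
  constructor
  · rintro ⟨x, hx, hxy⟩
    obtain rfl := Φ.injective hxy
    exact hx
  · exact fun hx => ⟨(p, q), hx, rfl⟩

theorem exists_of_mem_doubled {Φ : (R × R) ≃ₗ[K] S} {A : Submodule K R} {y : S}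
    (hy : y ∈ doubled Φ A) : ∃ p ∈ A, ∃ q ∈ A, y = Φ (p, q) := by
  obtain ⟨⟨p, q⟩, hx, rfl⟩ := hy
  exact ⟨p, hx.1, q, hx.2, rfl⟩

variable {σ : R →ₗ[K] R} {c : R} {Φ : (R × R) ≃ₗ[K] S} {A : Submodule K R} {e : R}

theorem IsUnitalIdeal.isAlgIdeal_doubled (h : IsUnitalIdeal A e) (hσ : IsCentralInvolution σ)
    (hΦ : IsDoubling σ c Φ) : IsAlgIdeal (doubled Φ A) := by
  intro y x hx
  obtain ⟨p, hp, q, hq, rfl⟩ := exists_of_mem_doubled hx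
  obtain ⟨⟨r, t⟩, rfl⟩ := Φ.surjective y
  rw [hΦ, hΦ, mem_doubled, mem_doubled]
  have hi := h.ideal
  have hs := h.star_mem hσ hq
  have hs' := h.star_mem hσ hp
  exact ⟨⟨A.add_mem (hi _ _ hp).1 (hi _ _ (hi _ _ hs).2).1,
      A.add_mem (hi _ _ hq).2 (hi _ _ hs').1⟩,
    A.add_mem (hi _ _ hp).2 (hi _ _ (hi _ _ hq).1).1, A.add_mem (hi _ _ hp).1 (hi _ _ hq).2⟩

/-- The double of a noncommutative simple ideal is simple. -/
theorem IsUnitalIdeal.isSimpleAlg_doubled (h : IsUnitalIdeal A e) (hσ : IsCentralInvolution σ)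
    (hΦ : IsDoubling σ c Φ) {c' : R} (hc : c' * c = 1) (hs : IsSimpleAlg A)
    (hne : ∃ x ∈ A, ∃ y ∈ A, x * y ≠ y * x) : IsSimpleAlg (doubled Φ A) := by
  have := h.isSimpleRing hs
  obtain ⟨F, _, _, _, _, τ, hτ, hτσ, -⟩ := h.exists_center_involution hσ hs
  obtain ⟨x, hx, y, hy, hxy⟩ := hne
  have he := h.star_unit hσ
  have hee := h.mul_left e h.mem
  have hmem : Φ (e, 0) ∈ doubled Φ A := mem_doubled.2 ⟨h.mem, A.zero_mem⟩
  have hmem' : Φ (0, e) ∈ doubled Φ A := mem_doubled.2 ⟨A.zero_mem, h.mem⟩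
  have hunit : ∀ r ∈ A, ∀ t ∈ A, Φ (e, 0) * Φ (r, t) = Φ (r, t) := fun r hr t ht => by
    rw [hΦ, h.mul_left r hr, h.mul_right t ht]; simp
  refine ⟨fun x hx y hy => (h.isAlgIdeal_doubled hσ hΦ x y hy).1,
    ⟨Φ (e, 0), hmem, Φ (e, 0), hmem, ?_⟩, fun J hJ hJI => ?_⟩
  · rw [hunit e h.mem 0 A.zero_mem]
    intro h0
    have h0 : e = 0 := congrArg Prod.fst (Φ.injective (h0.trans (map_zero Φ).symm))
    exact one_ne_zero (h.val_injective (h.val_one.trans (h0.trans (map_zero h.val).symm)))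
  -- The intersection of `J` with the undoubled copy of `A` is an ideal of a simple ring, hence zero
  -- or everything.
  · let J' : TwoSidedIdeal h.Carrier := TwoSidedIdeal.mk' {x | Φ (h.val x, 0) ∈ J}
      (by simp [show ((0 : R), (0 : R)) = 0 from rfl])
      (fun {x y} hx hy => by
        have := J.add_mem hx hy
        rw [← map_add, Prod.mk_add_mk, ← map_add, add_zero] at this
        exact this)
      (fun {x} hx => by
        have := J.neg_mem hx
        rw [← map_neg, Prod.neg_mk, ← map_neg, neg_zero] at this
        exact this)
      (fun {x y} hy => by
        have := (hJI (Φ (h.val x, 0)) (mem_doubled.2 ⟨h.val_mem x, A.zero_mem⟩) _ hy).1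
        rw [hΦ] at this
        simpa using this)
      (fun {x y} hx => by
        have := (hJI (Φ (h.val y, 0)) (mem_doubled.2 ⟨h.val_mem y, A.zero_mem⟩) _ hx).2
        rw [hΦ] at this
        simpa using this)
    have hJ' : ∀ x, x ∈ J' ↔ Φ (h.val x, 0) ∈ J := fun x => TwoSidedIdeal.mem_mk' ..
    rcases eq_bot_or_eq_top J' with h0 | h1
    · left
      have key : ∀ p ∈ A, ∀ q ∈ A, Φ (p, q) ∈ J → p = 0 := fun p hp q hq hpq => by
        have hz : h.elem p hp = 0 := by
          refine eq_zero_of_forall_mul_eq_mul_star (σ := τ) (x := h.elem x hx) (y := h.elem y hy)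
            (fun h' => hxy (congrArg h.val h')) (fun r => ?_) hτ.mul
          rw [← sub_eq_zero, ← TwoSidedIdeal.mem_bot, ← h0, hJ']
          -- Left multiplication by `r` and right multiplication by `σ r` act identically on the
          -- `u`-component. Their difference is `(rp - pσ(r), 0)`, which must vanish.
          have h3 := (hJI (Φ (h.val r, 0)) (mem_doubled.2 ⟨h.val_mem r, A.zero_mem⟩) _ hpq).1
          have h4 := (hJI (Φ (σ (h.val r), 0))
            (mem_doubled.2 ⟨h.star_mem hσ (h.val_mem r), A.zero_mem⟩) _ hpq).2
          have h5 := J.sub_mem h3 h4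
          rw [hΦ, hΦ, hσ.invol, ← map_sub] at h5
          simpa [hτσ] using h5
        exact congrArg h.val hz
      refine eq_bot_iff.2 fun y hy => ?_
      obtain ⟨p, hp, q, hq, rfl⟩ := exists_of_mem_doubled (hJ hy)
      obtain rfl := key p hp q hq hy
      -- Multiplying by `eu` moves `q` to the first component as `cq`, and `c` is invertible.
      have h3 := (hJI (Φ (0, e)) hmem' _ hy).2
      rw [hΦ, he, h.mul_left q hq] at h3
      have h4 := key _ (by simpa using (h.ideal c q hq).1) _ (by simp) h3
      have h5 : q = 0 := by
        rw [← one_mul q, ← hc, mul_assoc, show c * q = 0 by simpa using h4, mul_zero]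
      rw [h5]
      exact map_zero Φ
    · right
      refine le_antisymm hJ fun y hy => ?_
      obtain ⟨p, hp, q, hq, rfl⟩ := exists_of_mem_doubled hy
      have h3 : Φ (e, 0) ∈ J := (hJ' 1).1 (h1 ▸ TwoSidedIdeal.mem_top _)
      rw [← hunit p hp q hq]
      exact (hJI _ (mem_doubled.2 ⟨hp, hq⟩) _ h3).2

theorem IsUnitalIdeal.isQuaternionAlg_and_isCayleyAlg_doubled (h : IsUnitalIdeal A e)
    (hσ : IsCentralInvolution σ) (hΦ : IsDoubling σ c Φ) {c' : R} (hc : c' * c = 1)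
    (hcc : ∀ r, c * r = r * c) (h2 : (2 : K) ≠ 0) (hs : IsSimpleAlg A)
    (hne : ∃ x ∈ A, ∃ y ∈ A, x * y ≠ y * x) :
    IsQuaternionAlg A ∧ IsCayleyAlg (doubled Φ A) := by
  have := h.isSimpleRing hs
  obtain ⟨F, _, _, _, _, τ, hτ, hτσ, hF⟩ := h.exists_center_involution hσ hs
  obtain ⟨x, hx, y, hy, hxy⟩ := hne
  have h2F : (2 : F) ≠ 0 := by
    rw [← map_ofNat (algebraMap K F) 2]
    exact (map_ne_zero _).2 h2
  obtain ⟨α, β, hα, hβ, f, hf, hfs⟩ := hτ.exists_quaternion h2F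
    ⟨h.elem x hx, h.elem y hy, fun h' => hxy (congrArg h.val h')⟩
  let g : QuaternionAlgebra F α 0 β →ₗ[K] R := h.val.comp (f.toLinearMap.restrictScalars K)
  have hg : ∀ q, g q = h.val (f q) := fun q => rfl
  have hgm : ∀ p q, g (p * q) = g p * g q := fun p q => by simp [hg]
  have hg0 : ∀ q, g q = 0 → q = 0 := fun q hq =>
    (injective_iff_map_eq_zero f).1 hf.1 q (h.val_injective (by rw [map_zero]; exact hq))
  have hgA : ∀ q, g q ∈ A := fun q => h.val_mem _
  have hgs : ∀ y ∈ A, ∃ q, g q = y := fun y hy => by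
    obtain ⟨q, hq⟩ := hf.2 (h.elem y hy)
    exact ⟨q, by rw [hg, hq, h.val_elem]⟩
  have hgσ : ∀ q, σ (g q) = g (star q) := fun q => by rw [hg, hg, ← hτσ, hfs]
  -- The component of the central element `c` in `A` is central, hence a scalar `d`: the Cayley
  -- parameter.
  obtain ⟨d, hd⟩ := (hF (h.elem (c * e) (h.ideal c e h.mem).1)).1 fun y => h.val_injective (by
    rw [h.val_mul, h.val_mul, h.val_elem, mul_assoc, h.mul_left _ (h.val_mem y), ← mul_assoc, ← hcc,
      mul_assoc, h.mul_right _ (h.val_mem y)])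
  have hgd : ∀ q, g (d • q) = c * g q := fun q => by
    rw [hg, map_smul, Algebra.smul_def, hd, h.val_mul, h.val_elem, mul_assoc,
      h.mul_left _ (h.val_mem _), hg]
  refine ⟨⟨F, _, _, α, β, h2F, hα, hβ, .of_linearMap g hgm hg0 hgA hgs⟩,
    F, _, ‹_›, α, β, d, h2F, hα, hβ, ?_, ?_⟩
  · rintro rfl
    have h3 := hgd 1
    rw [zero_smul, map_zero] at h3
    have h4 : g 1 = 0 := by rw [← one_mul (g 1), ← hc, mul_assoc, ← h3, mul_zero]
    exact one_ne_zero (hg0 _ h4)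
  · let k : CayleyAlgebra F α β d →ₗ[K] S :=
      { toFun := fun x => Φ (g x.toProd.1, g x.toProd.2)
        map_add' := fun x y => by
          rw [CayleyAlgebra.toProd_add, Prod.fst_add, Prod.snd_add, map_add, map_add, ← map_add Φ,
            Prod.mk_add_mk]
        map_smul' := fun a x => by
          rw [show (a • x).toProd = a • x.toProd from rfl, RingHom.id_apply, Prod.smul_fst,
            Prod.smul_snd, map_smul, map_smul, ← map_smul Φ, Prod.smul_mk] }
    have hk : ∀ x, k x = Φ (g x.toProd.1, g x.toProd.2) := fun x => rfl
    refine .of_linearMap k (fun x y => ?_) (fun x hx => ?_) (fun x => ?_) fun y hy => ?_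
    · rw [hk, hk, hk, hΦ, CayleyAlgebra.toProd_mul]
      simp only [map_add, hgm, hgd, hgσ]
    · rw [hk] at hx
      have h3 := Φ.injective (hx.trans (map_zero Φ).symm)
      exact CayleyAlgebra.ext' (Prod.ext (hg0 _ (congrArg Prod.fst h3))
        (hg0 _ (congrArg Prod.snd h3)))
    · exact mem_doubled.2 ⟨hgA _, hgA _⟩
    · obtain ⟨p, hp, q, hq, rfl⟩ := exists_of_mem_doubled hy
      obtain ⟨p, rfl⟩ := hgs p hp
      obtain ⟨q, rfl⟩ := hgs q hq
      exact ⟨⟨(p, q)⟩, rfl⟩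

/-- A commutative simple ideal is a field, on which the involution is trivial. -/
theorem IsUnitalIdeal.exists_field (h : IsUnitalIdeal A e) (hσ : IsCentralInvolution σ)
    (hs : IsSimpleAlg A) (hcomm : ∀ x ∈ A, ∀ y ∈ A, x * y = y * x) :
    ∃ (F : Type v) (_ : Field F) (_ : Algebra K F) (g : F →ₗ[K] R), (∀ x y, g (x * y) = g x * g y) ∧
      g 1 = e ∧ (∀ x, g x = 0 → x = 0) ∧ (∀ x, g x ∈ A) ∧ (∀ y ∈ A, ∃ x, g x = y) ∧
      ∀ x, σ (g x) = g x := by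
  have := h.isSimpleRing hs
  obtain ⟨F, _, _, _, _, hF⟩ := exists_center_field K h.Carrier
  refine ⟨F, _, _, h.val.comp (IsScalarTower.toAlgHom K F h.Carrier).toLinearMap,
    fun x y => by simp, by simp, fun x hx => ?_, fun x => h.val_mem _, fun y hy => ?_, fun x => ?_⟩
  · have h3 : algebraMap F h.Carrier x = 0 := h.val_injective (by rw [map_zero]; exact hx)
    exact (map_eq_zero _).1 h3
  · obtain ⟨x, hx⟩ := (hF (h.elem y hy)).1 fun z => h.val_injective (hcomm y hy _ (h.val_mem z))
    exact ⟨x, congrArg h.val hx⟩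
  · exact (hσ.fixed _).2 (h.central_of_comm_carrier (h.val_mem _) fun y hy =>
      hcomm _ (h.val_mem _) y hy)

theorem IsUnitalIdeal.isFieldAlg (h : IsUnitalIdeal A e) (hσ : IsCentralInvolution σ)
    (hs : IsSimpleAlg A) (hcomm : ∀ x ∈ A, ∀ y ∈ A, x * y = y * x) : IsFieldAlg A := by
  obtain ⟨F, _, _, g, hgm, -, hg0, hgA, hgs, -⟩ := h.exists_field hσ hs hcomm
  exact ⟨F, _, _, .of_linearMap g hgm hg0 hgA hgs⟩

theorem IsUnitalIdeal.isTwoCopiesOfField_doubled (h : IsUnitalIdeal A e)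
    (hσ : IsCentralInvolution σ) (hΦ : IsDoubling σ c Φ) {c' : R} (hc : c' * c = 1)
    (h2 : (2 : K) ≠ 0) (hs : IsSimpleAlg A)
    (hcomm : ∀ x ∈ A, ∀ y ∈ A, x * y = y * x) (hw : ∃ w ∈ A, w * w = c * e) :
    IsTwoCopiesOfField (doubled Φ A) A := by
  obtain ⟨F, _, _, g, hgm, hg1, hg0, hgA, hgs, hgσ⟩ := h.exists_field hσ hs hcomm
  obtain ⟨w, hwA, hww⟩ := hw
  obtain ⟨w, rfl⟩ := hgs w hwA
  have h2F : (2 : F) ≠ 0 := by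
    rw [← map_ofNat (algebraMap K F) 2]
    exact (map_ne_zero _).2 h2
  have hgw : ∀ x, c * g x = g (w * w * x) := fun x => by
    rw [hgm, hgm, hww, mul_assoc, h.mul_left _ (hgA x)]
  have hw0 : w ≠ 0 := by
    rintro rfl
    have h3 := hgw 1
    rw [zero_mul, zero_mul, map_zero] at h3
    have h4 : g 1 = 0 := by rw [← one_mul (g 1), ← hc, mul_assoc, h3, mul_zero]
    exact one_ne_zero (hg0 _ h4)
  refine ⟨F, _, ‹_›, .of_linearMap g hgm hg0 hgA hgs, ?_⟩
  -- The inverse of `p + qu ↦ (p + wq, p - wq)`, the evaluations at the two roots `u = ±w`.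
  let k : F × F →ₗ[K] S :=
    { toFun := fun x => Φ (g ((x.1 + x.2) / 2), g ((x.1 - x.2) / (2 * w)))
      map_add' := fun x y => by
        rw [Prod.fst_add, Prod.snd_add, ← map_add Φ, Prod.mk_add_mk, ← map_add, ← map_add]
        refine congrArg Φ (Prod.ext (congrArg g ?_) (congrArg g ?_)) <;> ring
      map_smul' := fun a x => by
        rw [RingHom.id_apply, Prod.smul_fst, Prod.smul_snd, ← map_smul Φ, Prod.smul_mk, ← map_smul,
          ← map_smul, ← smul_add, ← smul_sub, smul_div_assoc, smul_div_assoc] }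
  have hk : ∀ x, k x = Φ (g ((x.1 + x.2) / 2), g ((x.1 - x.2) / (2 * w))) := fun x => rfl
  refine .of_linearMap k (fun x y => ?_) (fun x hx => ?_) (fun x => ?_) fun y hy => ?_
  · rw [hk, hk, hk, hΦ]
    simp only [hgσ, ← hgm, ← map_add, hgw, Prod.fst_mul, Prod.snd_mul]
    refine congrArg Φ (Prod.ext (congrArg g ?_) (congrArg g ?_)) <;> field_simp <;> ring
  · rw [hk] at hx
    have h3 := Φ.injective (hx.trans (map_zero Φ).symm)
    have h4 := hg0 _ (congrArg Prod.fst h3)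
    have h5 := hg0 _ (congrArg Prod.snd h3)
    rw [div_eq_zero_iff, or_iff_left h2F] at h4
    rw [div_eq_zero_iff, or_iff_left (mul_ne_zero h2F hw0)] at h5
    refine Prod.ext ?_ ?_
    · exact (mul_eq_zero.1 (show 2 * x.1 = 0 by linear_combination h4 + h5)).resolve_left h2F
    · exact (mul_eq_zero.1 (show 2 * x.2 = 0 by linear_combination h4 - h5)).resolve_left h2F
  · exact mem_doubled.2 ⟨hgA _, hgA _⟩
  · obtain ⟨p, hp, q, hq, rfl⟩ := exists_of_mem_doubled hy
    obtain ⟨p, rfl⟩ := hgs p hp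
    obtain ⟨q, rfl⟩ := hgs q hq
    refine ⟨(p + w * q, p - w * q), ?_⟩
    rw [hk]
    refine congrArg Φ (Prod.ext (congrArg g ?_) (congrArg g ?_)) <;> field_simp <;> ring

theorem IsUnitalIdeal.isFieldAlg_doubled (h : IsUnitalIdeal A e)
    (hσ : IsCentralInvolution σ) (hΦ : IsDoubling σ c Φ) (hs : IsSimpleAlg A)
    (hcomm : ∀ x ∈ A, ∀ y ∈ A, x * y = y * x) (hw : ¬ ∃ w ∈ A, w * w = c * e) :
    IsFieldAlg (doubled Φ A) := by
  obtain ⟨F, _, _, g, hgm, hg1, hg0, hgA, hgs, hgσ⟩ := h.exists_field hσ hs hcomm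
  obtain ⟨d, hd⟩ := hgs _ (h.ideal c e h.mem).1
  have hgd : ∀ x, c * g x = g (d * x) := fun x => by
    rw [hgm, hd, mul_assoc, h.mul_left _ (hgA x)]
  -- Irreducibility of `u² - d`, in the form from which `QuadraticAlgebra` derives its field
  -- structure.
  have : Fact (∀ r : F, r ^ 2 ≠ d + 0 * r) := ⟨fun r hr => hw ⟨g r, hgA r, by
    rw [← hgm, ← hd]; congr 1; linear_combination hr⟩⟩
  refine ⟨QuadraticAlgebra F d 0, inferInstance, inferInstance, ?_⟩
  let k : QuadraticAlgebra F d 0 →ₗ[K] S :=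
    { toFun := fun x => Φ (g x.re, g x.im)
      map_add' := fun x y => by
        rw [← map_add, Prod.mk_add_mk, ← map_add, ← map_add, QuadraticAlgebra.re_add,
          QuadraticAlgebra.im_add]
      map_smul' := fun a x => by
        rw [RingHom.id_apply, ← map_smul, Prod.smul_mk, ← map_smul, ← map_smul,
          QuadraticAlgebra.re_smul, QuadraticAlgebra.im_smul] }
  have hk : ∀ x, k x = Φ (g x.re, g x.im) := fun x => rfl
  refine .of_linearMap k (fun x y => ?_) (fun x hx => ?_) (fun x => ?_) fun y hy => ?_
  · rw [hk, hk, hk, hΦ]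
    simp only [hgσ, ← hgm, ← map_add, hgd, QuadraticAlgebra.re_mul, QuadraticAlgebra.im_mul]
    refine congrArg Φ (Prod.ext (congrArg g ?_) (congrArg g ?_)) <;> ring
  · rw [hk] at hx
    have h3 := Φ.injective (hx.trans (map_zero Φ).symm)
    exact QuadraticAlgebra.ext (hg0 _ (congrArg Prod.fst h3)) (hg0 _ (congrArg Prod.snd h3))
  · exact mem_doubled.2 ⟨hgA _, hgA _⟩
  · obtain ⟨p, hp, q, hq, rfl⟩ := exists_of_mem_doubled hy
    obtain ⟨p, rfl⟩ := hgs p hp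
    obtain ⟨q, rfl⟩ := hgs q hq
    exact ⟨⟨p, q⟩, rfl⟩

end Doubling

/-! ### Decompositions into ideals: doubling, refinement, existence -/

section Decompositions

variable {K : Type u} [Field K]

section NonAssoc

variable {S : Type v} [NonUnitalNonAssocRing S] [Module K S] {ι κ : Type} [DecidableEq ι]
  [DecidableEq κ]

theorem isInternal_of_projections {A : ι → Submodule K S} (π : ι → S →ₗ[K] S)
    (h1 : ∀ i, ∀ x ∈ A i, π i x = x) (h0 : ∀ i j, j ≠ i → ∀ x ∈ A j, π i x = 0)
    (htop : ∀ x, x ∈ ⨆ i, A i) : DirectSum.IsInternal A := by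
  refine DirectSum.isInternal_submodule_of_iSupIndep_of_iSup_eq_top (fun i => ?_)
    (eq_top_iff.2 fun x _ => htop x)
  rw [Submodule.disjoint_def]
  intro x hx hx'
  have : ⨆ j, ⨆ (_ : j ≠ i), A j ≤ LinearMap.ker (π i) := iSup₂_le fun j hj y hy => h0 i j hj y hy
  rw [← h1 i x hx]
  exact this hx'

theorem IsIdealDecomposition.mul_eq_zero {A : ι → Submodule K S} (hA : IsIdealDecomposition A)
    {i j : ι} (hij : i ≠ j) {x y : S} (hx : x ∈ A i) (hy : y ∈ A j) : x * y = 0 :=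
  Submodule.disjoint_def.1 (hA.2.submodule_iSupIndep.pairwiseDisjoint hij) _
    (hA.1 i y x hx).2 (hA.1 j x y hy).1

theorem IsIdealDecomposition.reindex {A : ι → Submodule K S} (hA : IsIdealDecomposition A)
    (σ : κ ≃ ι) : IsIdealDecomposition (A ∘ σ) := by
  refine ⟨fun i => hA.1 (σ i), DirectSum.isInternal_submodule_of_iSupIndep_of_iSup_eq_top
    (hA.2.submodule_iSupIndep.comp σ.injective) ?_⟩
  rw [← hA.2.submodule_iSup_eq_top]
  exact σ.iSup_comp

/-- The other summands annihilate `A i`, so an ideal of a summand is an ideal of the whole algebra.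
-/
theorem IsIdealDecomposition.mul_mem {A : ι → Submodule K S} (hA : IsIdealDecomposition A)
    {i : ι} {I : Submodule K S} (hI : I ≤ A i)
    (h : ∀ a ∈ A i, ∀ x ∈ I, a * x ∈ I ∧ x * a ∈ I) : IsAlgIdeal I := by
  intro a x hx
  have ha : a ∈ ⨆ j, A j := by rw [hA.2.submodule_iSup_eq_top]; trivial
  induction ha using Submodule.iSup_induction' with
  | mem j a ha =>
    by_cases hj : j = i
    · subst hj
      exact h a ha x hx
    · rw [hA.mul_eq_zero hj ha (hI hx), hA.mul_eq_zero (Ne.symm hj) (hI hx) ha]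
      exact ⟨I.zero_mem, I.zero_mem⟩
  | zero => simp
  | add a b _ _ ha hb =>
    rw [add_mul, mul_add]
    exact ⟨I.add_mem ha.1 hb.1, I.add_mem ha.2 hb.2⟩

theorem exists_split_of_isCopyOf_prod {I : Submodule K S} {F : Type v} [Field F] [Algebra K F]
    (h : IsCopyOf I (F × F)) : ∃ (J₁ J₂ : Submodule K S) (e₁ e₂ : S),
      IsFieldAlg J₁ ∧ IsFieldAlg J₂ ∧ J₁ ≤ I ∧ J₂ ≤ I ∧ I ≤ J₁ ⊔ J₂ ∧ e₁ ∈ J₁ ∧ e₂ ∈ J₂ ∧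
      (∀ x ∈ J₁, e₁ * x = x ∧ e₂ * x = 0) ∧ (∀ x ∈ J₂, e₁ * x = 0 ∧ e₂ * x = x) ∧
      (∀ a ∈ I, ∀ x ∈ J₁, a * x ∈ J₁ ∧ x * a ∈ J₁) ∧
      (∀ a ∈ I, ∀ x ∈ J₂, a * x ∈ J₂ ∧ x * a ∈ J₂) := by
  obtain ⟨f, hf, hr⟩ := h
  have hI : ∀ x, x ∈ I ↔ ∃ a, f a = x := fun x => by
    rw [← SetLike.mem_coe, ← hr]; rfl
  let g₁ : F →ₗ[K] S := (f : F × F →ₗ[K] S).comp (LinearMap.inl K F F)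
  let g₂ : F →ₗ[K] S := (f : F × F →ₗ[K] S).comp (LinearMap.inr K F F)
  have hg₁ : ∀ x, g₁ x = f (x, 0) := fun x => rfl
  have hg₂ : ∀ x, g₂ x = f (0, x) := fun x => rfl
  have h0 : ∀ x, f x = 0 → x = 0 := (injective_iff_map_eq_zero f).1 hf
  refine ⟨LinearMap.range g₁, LinearMap.range g₂, g₁ 1, g₂ 1,
    ⟨F, _, _, .of_linearMap g₁ (fun x y => ?_) (fun x hx => ?_) (fun x => ⟨x, rfl⟩) fun y hy => hy⟩,
    ⟨F, _, _, .of_linearMap g₂ (fun x y => ?_) (fun x hx => ?_) (fun x => ⟨x, rfl⟩) fun y hy => hy⟩,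
    ?_, ?_, ?_, ⟨1, rfl⟩, ⟨1, rfl⟩, ?_, ?_, ?_, ?_⟩
  · rw [hg₁, hg₁, hg₁, ← map_mul, Prod.mk_mul_mk, mul_zero]
  · exact congrArg Prod.fst (h0 _ hx)
  · rw [hg₂, hg₂, hg₂, ← map_mul, Prod.mk_mul_mk, mul_zero]
  · exact congrArg Prod.snd (h0 _ hx)
  · rintro _ ⟨x, rfl⟩
    exact (hI _).2 ⟨_, rfl⟩
  · rintro _ ⟨x, rfl⟩
    exact (hI _).2 ⟨_, rfl⟩
  · intro y hy
    obtain ⟨⟨a, b⟩, rfl⟩ := (hI _).1 hy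
    refine Submodule.mem_sup.2 ⟨_, ⟨a, rfl⟩, _, ⟨b, rfl⟩, ?_⟩
    rw [hg₁, hg₂, ← map_add]; simp
  · rintro _ ⟨x, rfl⟩
    rw [hg₁, hg₁, hg₂, ← map_mul, ← map_mul]
    simp [show ((0 : F), (0 : F)) = 0 from rfl]
  · rintro _ ⟨x, rfl⟩
    rw [hg₁, hg₂, hg₂, ← map_mul, ← map_mul]
    simp [show ((0 : F), (0 : F)) = 0 from rfl]
  · rintro a ha _ ⟨x, rfl⟩
    obtain ⟨⟨a, b⟩, rfl⟩ := (hI _).1 ha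
    exact ⟨⟨a * x, by rw [hg₁, hg₁, ← map_mul]; simp⟩, ⟨x * a, by rw [hg₁, hg₁, ← map_mul]; simp⟩⟩
  · rintro a ha _ ⟨x, rfl⟩
    obtain ⟨⟨a, b⟩, rfl⟩ := (hI _).1 ha
    exact ⟨⟨b * x, by rw [hg₂, hg₂, ← map_mul]; simp⟩, ⟨x * b, by rw [hg₂, hg₂, ← map_mul]; simp⟩⟩

/-- If the summands with index in `ι` are sums of two copies of a field, they can be split. -/
theorem IsIdealDecomposition.exists_refinement [SMulCommClass K S S]
    {A : ι ⊕ κ → Submodule K S} (hA : IsIdealDecomposition A)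
    (h : ∀ i, ∃ (F : Type v) (_ : Field F) (_ : Algebra K F), IsCopyOf (A (.inl i)) (F × F)) :
    ∃ J : ι ⊕ ι → Submodule K S, (∀ i, IsFieldAlg (J i)) ∧
      IsIdealDecomposition (Sum.elim J (fun j => A (.inr j))) := by
  have h' := fun i => (h i).elim fun F h => h.elim fun _ h => h.elim fun _ h =>
    exists_split_of_isCopyOf_prod h
  choose J₁ J₂ e₁ e₂ hF₁ hF₂ hle₁ hle₂ hsup he₁ he₂ hJ₁ hJ₂ hi₁ hi₂ using h'
  have hz : ∀ {i j : ι ⊕ κ}, i ≠ j → ∀ {x y : S}, x ∈ A i → y ∈ A j → x * y = 0 :=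
    fun hij _ _ => hA.mul_eq_zero hij
  let E := LinearEquiv.ofBijective (DirectSum.coeLinearMap A) hA.2
  -- Coordinate projections serve the untouched summands, for which no unit is given; the halves of
  -- the split ones are separated by left multiplication by `e₁` and `e₂`.
  let p : ι ⊕ κ → S →ₗ[K] S := fun i =>
    (A i).subtype.comp ((DirectSum.component K (ι ⊕ κ) (fun i => A i) i).comp E.symm.toLinearMap)
  have hE : ∀ i (x : S) (hx : x ∈ A i), E.symm x = DirectSum.lof K (ι ⊕ κ) (fun i => A i) i ⟨x, hx⟩ :=
    fun i x hx => E.injective (by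
      rw [E.apply_symm_apply]; exact (DirectSum.coeLinearMap_lof A i ⟨x, hx⟩).symm)
  have hp1 : ∀ i, ∀ x ∈ A i, p i x = x := fun i x hx => by
    simp only [p, LinearMap.comp_apply, LinearEquiv.coe_coe, hE i x hx, DirectSum.component.lof_self,
      Submodule.subtype_apply]
  have hp0 : ∀ i j, j ≠ i → ∀ x ∈ A j, p i x = 0 := fun i j hij x hx => by
    simp only [p, LinearMap.comp_apply, LinearEquiv.coe_coe, hE j x hx]
    rw [DirectSum.component.of, dif_neg hij, map_zero]
  refine ⟨Sum.elim J₁ J₂, by rintro (i | i); exacts [hF₁ i, hF₂ i], ?_, ?_⟩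
  · rintro ((i | i) | j)
    · exact hA.mul_mem (hle₁ i) (hi₁ i)
    · exact hA.mul_mem (hle₂ i) (hi₂ i)
    · exact hA.1 (.inr j)
  · refine isInternal_of_projections (Sum.elim (Sum.elim (fun i => LinearMap.mulLeft K (e₁ i))
      (fun i => LinearMap.mulLeft K (e₂ i))) (fun j => p (.inr j))) ?_ ?_ ?_
    · rintro ((i | i) | j) x hx
      · exact (hJ₁ i x hx).1
      · exact (hJ₂ i x hx).2
      · exact hp1 _ x hx
    · rintro ((i | i) | j) ((i' | i') | j') hne x hx
      · exact hz (by simpa using Ne.symm hne) (hle₁ _ (he₁ i)) (hle₁ _ hx)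
      · by_cases hii : i = i'
        · subst hii; exact (hJ₂ i x hx).1
        · exact hz (by simpa using hii) (hle₁ _ (he₁ i)) (hle₂ _ hx)
      · exact hz (by simp) (hle₁ _ (he₁ i)) hx
      · by_cases hii : i = i'
        · subst hii; exact (hJ₁ i x hx).2
        · exact hz (by simpa using hii) (hle₂ _ (he₂ i)) (hle₁ _ hx)
      · exact hz (by simpa using Ne.symm hne) (hle₂ _ (he₂ i)) (hle₂ _ hx)
      · exact hz (by simp) (hle₂ _ (he₂ i)) hx
      · exact hp0 _ _ (by simp) x (hle₁ _ hx)
      · exact hp0 _ _ (by simp) x (hle₂ _ hx)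
      · exact hp0 _ _ (by simpa using hne) x hx
    · intro x
      have hx : x ∈ ⨆ i, A i := by rw [hA.2.submodule_iSup_eq_top]; trivial
      refine (iSup_le ?_ : ⨆ i, A i ≤ _) hx
      rintro (i | j)
      · exact (hsup i).trans (sup_le
          (le_iSup (Sum.elim (Sum.elim J₁ J₂) fun j => A (.inr j)) (.inl (.inl i)))
          (le_iSup (Sum.elim (Sum.elim J₁ J₂) fun j => A (.inr j)) (.inl (.inr i))))
      · exact le_iSup (Sum.elim (Sum.elim J₁ J₂) fun j => A (.inr j)) (.inr j)

end NonAssoc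

section Assoc

variable {R : Type v} [Ring R] [Algebra K R] {ι : Type} [Fintype ι] [DecidableEq ι]

/-- The components of `1` are the units of the summands, because distinct summands annihilate each
other. -/
theorem IsIdealDecomposition.exists_units {A : ι → Submodule K R} (hA : IsIdealDecomposition A) :
    ∃ e : ι → R, (∀ i, IsUnitalIdeal (A i) (e i)) ∧ ∑ i, e i = 1 := by
  classical
  have h1 : (1 : R) ∈ ⨆ i, A i := by rw [hA.2.submodule_iSup_eq_top]; trivial
  obtain ⟨e, he⟩ := (Submodule.mem_iSup_iff_exists_dfinsupp' A 1).1 h1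
  have hsum : ∑ i, (e i : R) = 1 := by
    rw [← he, DFinsupp.sum_eq_sum_fintype]
    · rfl
    · exact fun _ => rfl
  refine ⟨fun i => e i, fun i => ⟨hA.1 i, (e i).2, fun x hx => ?_, fun x hx => ?_⟩, hsum⟩
  · conv_rhs => rw [← one_mul x, ← hsum, Finset.sum_mul]
    rw [Finset.sum_eq_single i (fun j _ hj => hA.mul_eq_zero hj (e j).2 hx) (by simp)]
  · conv_rhs => rw [← mul_one x, ← hsum, Finset.mul_sum]
    rw [Finset.sum_eq_single i (fun j _ hj => hA.mul_eq_zero (Ne.symm hj) hx (e j).2) (by simp)]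

variable {S : Type v} [NonUnitalNonAssocRing S] [Module K S]
  {σ : R →ₗ[K] R} {c : R} {Φ : (R × R) ≃ₗ[K] S}

theorem IsIdealDecomposition.doubled {A : ι → Submodule K R} (hA : IsIdealDecomposition A)
    (hσ : IsCentralInvolution σ) (hΦ : IsDoubling σ c Φ) :
    IsIdealDecomposition (fun i => doubled Φ (A i)) := by
  obtain ⟨e, he, hsum⟩ := hA.exists_units
  refine ⟨fun i => (he i).isAlgIdeal_doubled hσ hΦ, ?_⟩
  let π : ι → S →ₗ[K] S := fun i => Φ.toLinearMap.comp
    (((LinearMap.mulLeft K (e i)).prodMap (LinearMap.mulLeft K (e i))).comp Φ.symm.toLinearMap)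
  have hπ : ∀ i p q, π i (Φ (p, q)) = Φ (e i * p, e i * q) := fun i p q => by simp [π]
  refine isInternal_of_projections π (fun i x hx => ?_) (fun i j hij x hx => ?_) fun x => ?_
  · obtain ⟨p, hp, q, hq, rfl⟩ := exists_of_mem_doubled hx
    rw [hπ, (he i).mul_left p hp, (he i).mul_left q hq]
  · obtain ⟨p, hp, q, hq, rfl⟩ := exists_of_mem_doubled hx
    rw [hπ, hA.mul_eq_zero (Ne.symm hij) (he i).mem hp, hA.mul_eq_zero (Ne.symm hij) (he i).mem hq]
    exact map_zero Φ
  · obtain ⟨⟨p, q⟩, rfl⟩ := Φ.surjective x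
    have : Φ (p, q) = ∑ i, Φ (e i * p, e i * q) := by
      rw [← map_sum]
      congr 1
      ext
      · rw [Prod.fst_sum, ← Finset.sum_mul, hsum, one_mul]
      · rw [Prod.snd_sum, ← Finset.sum_mul, hsum, one_mul]
    rw [this]
    exact Submodule.sum_mem _ fun i _ => Submodule.mem_iSup_of_mem i
      (mem_doubled.2 ⟨((he i).ideal _ _ (he i).mem).2, ((he i).ideal _ _ (he i).mem).2⟩)

end Assoc

theorem exists_simple_decomposition_of_pi {R : Type v} [Ring R] [Algebra K R] {ι : Type}
    [DecidableEq ι] [Finite ι] {T : ι → Type w} [∀ i, Ring (T i)]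
    [∀ i, Algebra K (T i)] [∀ i, IsSimpleRing (T i)] (E : R ≃ₐ[K] Π i, T i) :
    ∃ A : ι → Submodule K R, IsIdealDecomposition A ∧ ∀ i, IsSimpleAlg (A i) := by
  have := Fintype.ofFinite ι
  let g : ∀ i, T i →ₗ[K] R := fun i => E.symm.toLinearMap.comp (LinearMap.single K T i)
  have hg : ∀ i x, g i x = E.symm (Pi.single i x) := fun i x => rfl
  have hEg : ∀ i x, E (g i x) = Pi.single i x := fun i x => by rw [hg, E.apply_symm_apply]
  have hcopy : ∀ i, IsCopyOf (LinearMap.range (g i)) (T i) := fun i =>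
    .of_linearMap (g i) (fun x y => by rw [hg, hg, hg, ← map_mul, Pi.single_mul])
      (fun x hx => by
        have := hEg i x
        rw [hx, map_zero] at this
        exact Pi.single_eq_zero_iff.1 this.symm) (fun x => ⟨x, rfl⟩) (fun y hy => hy)
  refine ⟨fun i => LinearMap.range (g i), ⟨fun i a x hx => ?_, ?_⟩, fun i => (hcopy i).isSimpleAlg⟩
  · obtain ⟨x, rfl⟩ := hx
    refine ⟨⟨E a i * x, E.injective ?_⟩, ⟨x * E a i, E.injective ?_⟩⟩
    · rw [map_mul E, hEg, hEg]
      ext j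
      by_cases hj : j = i
      · subst hj; simp
      · simp [hj]
    · rw [map_mul E, hEg, hEg]
      ext j
      by_cases hj : j = i
      · subst hj; simp
      · simp [hj]
  · refine isInternal_of_projections
      (fun i => (g i).comp ((LinearMap.proj i).comp E.toLinearMap)) ?_ ?_ fun x => ?_
    · rintro i _ ⟨x, rfl⟩
      simp [hEg]
    · rintro i j hij _ ⟨x, rfl⟩
      simp [hEg, Pi.single_eq_of_ne (Ne.symm hij)]
    · have : x = ∑ i, g i (E x i) := E.injective (by
        rw [map_sum]
        simp only [hEg]
        exact (Finset.univ_sum_single (E x)).symm)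
      rw [this]
      exact Submodule.sum_mem _ fun i _ => Submodule.mem_iSup_of_mem i ⟨_, rfl⟩

end Decompositions

/-- Artin–Wedderburn: matrix rings over division rings are simple. -/
theorem exists_simple_decomposition (K : Type u) [Field K] (R : Type v) [Ring R] [Algebra K R]
    [IsSemisimpleRing R] : ∃ (r : ℕ) (A : Fin r → Submodule K R),
      IsIdealDecomposition A ∧ ∀ i, IsSimpleAlg (A i) := by
  obtain ⟨n, D, d, _, _, _, ⟨E⟩⟩ := IsSemisimpleRing.exists_algEquiv_pi_matrix_divisionRing K R
  exact ⟨n, exists_simple_decomposition_of_pi E⟩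

/-! ### RA loops, and the loop algebra as a double of the group algebra -/

section RALoops

variable {G : Type u} [Group G] (D : DoublingDatum G)

namespace DoubledLoop

variable {D}

theorem inG_mul_inG (g h : G) : (inG g * inG h : DoubledLoop D) = inG (g * h) := rfl
theorem inG_mul_inGu (g h : G) : (inG g * inGu h : DoubledLoop D) = inGu (h * g) := rfl
theorem inGu_mul_inG (g h : G) : (inGu g * inG h : DoubledLoop D) = inGu (g * D.star h) := rfl
theorem inGu_mul_inGu (g h : G) :
    (inGu g * inGu h : DoubledLoop D) = inG (D.g₀ * D.star h * g) := rfl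

theorem inG_injective : Function.Injective (inG : G → DoubledLoop D) := fun _ _ h => by
  injection h

theorem inGu_injective : Function.Injective (inGu : G → DoubledLoop D) := fun _ _ h => by
  injection h

variable (D) in
/-- `L = G ∪ Gu`. -/
def equivSum : DoubledLoop D ≃ G ⊕ G where
  toFun x := match x with
    | inG g => .inl g
    | inGu g => .inr g
  invFun x := x.elim inG inGu
  left_inv x := by cases x <;> rfl
  right_inv x := by cases x <;> rfl

theorem natCard [Finite G] : Nat.card (DoubledLoop D) = 2 * Nat.card G := by
  rw [Nat.card_congr (equivSum D), Nat.card_sum, two_mul]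

end DoubledLoop

variable {D}

open DoubledLoop in
/-- The consequence of the alternative laws for the elements of `G`. -/
theorem IsRALoop.mul_star_cases (hRA : IsRALoop (DoubledLoop D)) (g k : G) :
    (g * k = k * g ∧ D.star g * k = k * D.star g) ∨
      (g * k = k * D.star g ∧ D.star g * k = k * g) := by
  have halt := fun x y => ((hRA ℤ).1 x y).2
  have hlin : ∀ a b y : MonoidAlgebra ℤ (DoubledLoop D),
      a * (b * y) + b * (a * y) = a * b * y + b * a * y := fun a b y => by
    have h1 := halt (a + b) y
    simp only [add_mul, mul_add] at h1
    rw [halt a y, halt b y] at h1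
    rw [← sub_eq_zero] at h1 ⊢
    rw [← h1]
    abel
  -- For the triple `g`, `u`, `k*` the linearised law reads `(kg)u + (kg*)u = (gk)u + (g*k)u`. Over
  -- `ℤ` the basis elements must match in pairs, since `1 + 1 ≠ 0`.
  have h := hlin (MonoidAlgebra.single (inG g) 1) (MonoidAlgebra.single (inGu 1) 1)
    (MonoidAlgebra.single (inG (D.star k)) 1)
  simp only [MonoidAlgebra.single_mul_single, inG_mul_inG, inG_mul_inGu, inGu_mul_inG, D.star_mul,
    D.star_star, one_mul, mul_one] at h
  rw [MonoidAlgebra.single_add_single_inj one_ne_zero one_ne_zero] at h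
  simp only [inGu_injective.eq_iff] at h
  rcases h with ⟨h1, h2⟩ | ⟨-, h1, h2⟩ | ⟨h0, -⟩
  · exact .inl ⟨h1.symm, h2.symm⟩
  · exact .inr ⟨h2.symm, h1.symm⟩
  · exact absurd h0 (by norm_num)

/-- If `k` and `h` do not commute, neither do `zk` and `h`. So `kh = hk*` and `zkh = h(zk)* =
hk*z*`; comparison gives `z = z*`. -/
theorem IsRALoop.star_of_comm (hRA : IsRALoop (DoubledLoop D)) {z : G}
    (hz : ∀ k, z * k = k * z) : D.star z = z := by
  obtain ⟨k, h, hkh⟩ := D.nonabelian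
  have h1 : k * h = h * D.star k := ((hRA.mul_star_cases k h).resolve_left fun h' => hkh h'.1).1
  have h2 : z * k * h ≠ h * (z * k) := by
    rw [mul_assoc, ← mul_assoc h, ← hz h, mul_assoc z h]
    exact fun h' => hkh (mul_left_cancel h')
  have h3 := ((hRA.mul_star_cases (z * k) h).resolve_left fun h' => h2 h'.1).1
  rw [D.star_mul, mul_assoc, h1, ← mul_assoc h, hz] at h3
  exact (mul_left_cancel h3).symm

variable (K : Type v) [Field K] (D)

/-- The linear extension of the involution of `G` to the group algebra. -/
noncomputable def algStar : MonoidAlgebra K G →ₗ[K] MonoidAlgebra K G :=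
  MonoidAlgebra.mapDomainLinearMap K K D.star

theorem algStar_single (g : G) (r : K) :
    algStar D K (MonoidAlgebra.single g r) = MonoidAlgebra.single (D.star g) r :=
  MonoidAlgebra.mapDomainLinearMap_single ..

theorem algStar_mul (a b : MonoidAlgebra K G) :
    algStar D K (a * b) = algStar D K b * algStar D K a := by
  induction a using MonoidAlgebra.induction_linear with
  | zero => simp
  | add a a' ha ha' => simp only [add_mul, mul_add, map_add, ha, ha']
  | single g r =>
    induction b using MonoidAlgebra.induction_linear with
    | zero => simp
    | add b b' hb hb' => simp only [add_mul, mul_add, map_add, hb, hb']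
    | single h s =>
      simp only [MonoidAlgebra.single_mul_single, algStar_single, D.star_mul, mul_comm]

theorem algStar_algStar (a : MonoidAlgebra K G) : algStar D K (algStar D K a) = a := by
  induction a using MonoidAlgebra.induction_linear with
  | zero => simp
  | add a a' ha ha' => simp only [map_add, ha, ha']
  | single g r => simp only [algStar_single, D.star_star]

theorem coeff_algStar (a : MonoidAlgebra K G) (g : G) :
    (algStar D K a).coeff g = a.coeff (D.star g) := by
  have hinj : Function.Injective D.star := Function.LeftInverse.injective D.star_star
  have := Finsupp.mapDomain_apply hinj a.coeff (D.star g)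
  rwa [D.star_star] at this

variable {D}

theorem IsRALoop.add_algStar_comm (hRA : IsRALoop (DoubledLoop D)) (a b : MonoidAlgebra K G) :
    (a + algStar D K a) * b = b * (a + algStar D K a) := by
  induction a using MonoidAlgebra.induction_linear with
  | zero => simp
  | add a a' ha ha' =>
    rw [map_add, add_add_add_comm, add_mul, ha, ha', ← mul_add]
  | single g r =>
    induction b using MonoidAlgebra.induction_linear with
    | zero => simp
    | add b b' hb hb' => rw [mul_add, hb, hb', add_mul]
    | single h s =>
      simp only [algStar_single, add_mul, mul_add, MonoidAlgebra.single_mul_single, mul_comm s r]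
      rcases hRA.mul_star_cases g h with ⟨h1, h2⟩ | ⟨h1, h2⟩
      · rw [h1, h2]
      · rw [h1, h2, add_comm]

/-- If `σ a = a`, then `2a = a + σ a` is central. Conversely, coefficients of a central element are
constant on conjugacy classes, and `g*` equals `g` for central `g` and is conjugate to `g`
otherwise. -/
theorem IsRALoop.isCentralInvolution (hRA : IsRALoop (DoubledLoop D)) (h2 : (2 : K) ≠ 0) :
    IsCentralInvolution (algStar D K) := by
  refine ⟨algStar_mul D K, algStar_algStar D K, fun a => ⟨fun ha b => ?_, fun ha => ?_⟩⟩
  · have h := hRA.add_algStar_comm K a b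
    rw [ha, ← two_smul K, smul_mul_assoc, mul_smul_comm] at h
    exact smul_right_injective _ h2 h
  · ext g
    rw [coeff_algStar]
    by_cases hg : ∀ k, g * k = k * g
    · rw [hRA.star_of_comm hg]
    · push Not at hg
      obtain ⟨k, hk⟩ := hg
      have h1 := ((hRA.mul_star_cases g k).resolve_left fun h' => hk h'.1).1
      -- Since `gk = kg*`, the coefficient at `gk` of `ak` is that of `a` at `g`, and the one of
      -- `ka` is that of `a` at `g*`.
      have h3 := congrArg (fun x => x.coeff (g * k)) (ha (MonoidAlgebra.single k 1))
      rw [MonoidAlgebra.coeff_mul_single_apply, MonoidAlgebra.coeff_single_mul_apply, h1,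
        inv_mul_cancel_left, ← h1, mul_inv_cancel_right, mul_one, one_mul] at h3
      exact h3.symm

variable (D)

/-- The embedding `KGu → KL`, `a ↦ au`. -/
noncomputable def groupAlgToLoopAlgU : MonoidAlgebra K G →ₗ[K] MonoidAlgebra K (DoubledLoop D) :=
  MonoidAlgebra.mapDomainLinearMap K K DoubledLoop.inGu

theorem groupAlgToLoopAlg_single (g : G) (r : K) : groupAlgToLoopAlg K D (.single g r) =
    .single (.inG g) r := MonoidAlgebra.mapDomainLinearMap_single ..

theorem groupAlgToLoopAlgU_single (g : G) (r : K) : groupAlgToLoopAlgU D K (.single g r) =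
    .single (.inGu g) r := MonoidAlgebra.mapDomainLinearMap_single ..

/-- `KL = KG + KGu`. -/
noncomputable def loopAlgEquiv :
    (MonoidAlgebra K G × MonoidAlgebra K G) ≃ₗ[K] MonoidAlgebra K (DoubledLoop D) :=
  .ofBijective ((groupAlgToLoopAlg K D).coprod (groupAlgToLoopAlgU D K)) <| by
    have hr : ∀ g : G, (DoubledLoop.inG g : DoubledLoop D) ∉ Set.range DoubledLoop.inGu := by
      rintro g ⟨h, hh⟩; cases hh
    have hr' : ∀ g : G, (DoubledLoop.inGu g : DoubledLoop D) ∉ Set.range DoubledLoop.inG := by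
      rintro g ⟨h, hh⟩; cases hh
    constructor
    · rw [injective_iff_map_eq_zero]
      rintro ⟨p, q⟩ h
      rw [LinearMap.coprod_apply] at h
      have h' : p.coeff.mapDomain (DoubledLoop.inG (D := D)) +
        q.coeff.mapDomain DoubledLoop.inGu = 0 := congrArg MonoidAlgebra.coeff h
      refine Prod.ext (MonoidAlgebra.ext (Finsupp.ext fun g => ?_))
        (MonoidAlgebra.ext (Finsupp.ext fun g => ?_))
      · have := DFunLike.congr_fun h' (DoubledLoop.inG g)
        rwa [Finsupp.add_apply, Finsupp.mapDomain_apply DoubledLoop.inG_injective,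
          Finsupp.mapDomain_of_notMem_range _ _ (hr g), add_zero] at this
      · have := DFunLike.congr_fun h' (DoubledLoop.inGu g)
        rwa [Finsupp.add_apply, Finsupp.mapDomain_apply DoubledLoop.inGu_injective,
          Finsupp.mapDomain_of_notMem_range _ _ (hr' g), zero_add] at this
    · intro y
      induction y using MonoidAlgebra.induction_linear with
      | zero => exact ⟨0, map_zero _⟩
      | add y y' hy hy' =>
        obtain ⟨x, rfl⟩ := hy
        obtain ⟨x', rfl⟩ := hy'
        exact ⟨x + x', map_add _ _ _⟩
      | single g r =>
        cases g with
        | inG g => exact ⟨(.single g r, 0), by simp [groupAlgToLoopAlg_single]⟩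
        | inGu g => exact ⟨(0, .single g r), by simp [groupAlgToLoopAlgU_single]⟩

theorem loopAlgEquiv_apply (p q : MonoidAlgebra K G) :
    loopAlgEquiv D K (p, q) = groupAlgToLoopAlg K D p + groupAlgToLoopAlgU D K q := rfl

theorem groupAlgToLoopAlg_mul (p r : MonoidAlgebra K G) :
    groupAlgToLoopAlg K D p * groupAlgToLoopAlg K D r = groupAlgToLoopAlg K D (p * r) := by
  induction p using MonoidAlgebra.induction_linear with
  | zero => simp
  | add a a' ha ha' => simp only [add_mul, map_add, ha, ha']
  | single g s =>
    induction r using MonoidAlgebra.induction_linear with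
    | zero => simp
    | add b b' hb hb' => simp only [mul_add, map_add, hb, hb']
    | single h t =>
      simp only [MonoidAlgebra.single_mul_single, groupAlgToLoopAlg_single, DoubledLoop.inG_mul_inG]

theorem groupAlgToLoopAlg_mul_U (p t : MonoidAlgebra K G) :
    groupAlgToLoopAlg K D p * groupAlgToLoopAlgU D K t = groupAlgToLoopAlgU D K (t * p) := by
  induction p using MonoidAlgebra.induction_linear with
  | zero => simp
  | add a a' ha ha' => simp only [add_mul, mul_add, map_add, ha, ha']
  | single g s =>
    induction t using MonoidAlgebra.induction_linear with
    | zero => simp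
    | add b b' hb hb' => simp only [add_mul, mul_add, map_add, hb, hb']
    | single h t =>
      simp only [MonoidAlgebra.single_mul_single, groupAlgToLoopAlg_single,
        groupAlgToLoopAlgU_single, DoubledLoop.inG_mul_inGu, mul_comm]

theorem groupAlgToLoopAlgU_mul (q r : MonoidAlgebra K G) :
    groupAlgToLoopAlgU D K q * groupAlgToLoopAlg K D r =
      groupAlgToLoopAlgU D K (q * algStar D K r) := by
  induction q using MonoidAlgebra.induction_linear with
  | zero => simp
  | add a a' ha ha' => simp only [add_mul, map_add, ha, ha']
  | single g s =>
    induction r using MonoidAlgebra.induction_linear with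
    | zero => simp
    | add b b' hb hb' => simp only [mul_add, map_add, hb, hb']
    | single h t =>
      simp only [MonoidAlgebra.single_mul_single, groupAlgToLoopAlg_single,
        groupAlgToLoopAlgU_single, algStar_single, DoubledLoop.inGu_mul_inG]

theorem groupAlgToLoopAlgU_mul_U (q t : MonoidAlgebra K G) :
    groupAlgToLoopAlgU D K q * groupAlgToLoopAlgU D K t =
      groupAlgToLoopAlg K D (.single D.g₀ 1 * (algStar D K t * q)) := by
  induction q using MonoidAlgebra.induction_linear with
  | zero => simp
  | add a a' ha ha' => simp only [add_mul, mul_add, map_add, ha, ha']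
  | single g s =>
    induction t using MonoidAlgebra.induction_linear with
    | zero => simp
    | add b b' hb hb' => simp only [add_mul, mul_add, map_add, hb, hb']
    | single h t =>
      simp only [MonoidAlgebra.single_mul_single, groupAlgToLoopAlg_single, one_mul,
        groupAlgToLoopAlgU_single, algStar_single, DoubledLoop.inGu_mul_inGu, mul_comm s t,
        mul_assoc]

theorem isDoubling_loopAlgEquiv :
    IsDoubling (algStar D K) (MonoidAlgebra.single D.g₀ 1) (loopAlgEquiv D K) := by
  intro p q r t
  simp only [loopAlgEquiv_apply, add_mul, mul_add, groupAlgToLoopAlg_mul, groupAlgToLoopAlg_mul_U,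
    groupAlgToLoopAlgU_mul, groupAlgToLoopAlgU_mul_U, map_add]
  abel

theorem doubledSubspace_eq_doubled (A : Submodule K (MonoidAlgebra K G)) :
    doubledSubspace D A = doubled (loopAlgEquiv D K) A := by
  have hU : (LinearMap.mulRight K (MonoidAlgebra.single (DoubledLoop.inGu 1) 1 :
      MonoidAlgebra K (DoubledLoop D))).comp (groupAlgToLoopAlg K D) = groupAlgToLoopAlgU D K := by
    refine LinearMap.ext fun a => ?_
    rw [LinearMap.comp_apply, LinearMap.mulRight_apply, ← groupAlgToLoopAlgU_single,
      groupAlgToLoopAlg_mul_U, ← MonoidAlgebra.one_def, one_mul]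
  rw [doubledSubspace, hU]
  apply le_antisymm
  · refine sup_le ?_ ?_
    · rintro _ ⟨a, ha, rfl⟩
      exact ⟨(a, 0), ⟨ha, A.zero_mem⟩, by simp [loopAlgEquiv_apply]⟩
    · rintro _ ⟨a, ha, rfl⟩
      exact ⟨(0, a), ⟨A.zero_mem, ha⟩, by simp [loopAlgEquiv_apply]⟩
  · rintro y hy
    obtain ⟨p, hp, q, hq, rfl⟩ := exists_of_mem_doubled hy
    exact Submodule.mem_sup.2 ⟨_, ⟨p, hp, rfl⟩, _, ⟨q, hq, rfl⟩, rfl⟩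

end RALoops

/-! ### The classes of loops -/

section Classes

variable {G : Type u} [Group G] {D : DoublingDatum G}

/-- Either `g₀ = 1`, or `g₀` is the word `p`, which the relator `x²p⁻¹` makes equal to `x²`. -/
theorem IsOfRAType.isSquare_g₀ {k : ℕ} {p q r : FreeGroup (RAGen k)} (h : IsOfRAType D k p q r)
    (hr : r = 1 ∨ r = p) : ∃ g : G, g * g = D.g₀ := by
  obtain ⟨m, -, φ, hφ⟩ := h
  rcases hr with rfl | rfl
  · exact ⟨1, by rw [hφ, map_one, map_one, one_mul]⟩
  · refine ⟨φ (PresentedGroup.mk _ (FreeGroup.of RAGen.x)), ?_⟩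
    rw [hφ, ← map_mul, ← map_mul, ← pow_two]
    congr 1
    exact QuotientGroup.eq_iff_div_mem.2 (Subgroup.subset_normalClosure (by
      rw [div_eq_mul_inv]; exact RARelator.sq_x))

theorem isSquare_g₀_of_mem_classes
    (h : InClassL1 D ∨ InClassL2 D ∨ InClassL3 D ∨ InClassL4 D ∨ InClassL5 D) :
    ∃ g : G, g * g = D.g₀ := by
  rcases h with h | h | h | h | h
  · exact h.isSquare_g₀ (.inl rfl)
  · exact h.isSquare_g₀ (.inr rfl)
  · exact h.isSquare_g₀ (.inl rfl)
  · exact h.isSquare_g₀ (.inr rfl)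
  · exact h.isSquare_g₀ (.inl rfl)

end Classes

theorem mainTheorem7 {G : Type u} [Group G] [Finite G] (D : DoublingDatum G)
    (hRA : IsRALoop (DoubledLoop D)) (K : Type v) [Field K]
    (hK : ¬ ringChar K ∣ Nat.card (DoubledLoop D)) :
    (∃ (r : ℕ) (A : Fin r → Submodule K (MonoidAlgebra K G)),
      IsIdealDecomposition A ∧ ∀ i, IsSimpleAlg (A i)) ∧
    (∀ (r : ℕ) (A : Fin r → Submodule K (MonoidAlgebra K G)),
      IsIdealDecomposition A → (∀ i, IsSimpleAlg (A i)) →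
        IsIdealDecomposition (fun i => doubledSubspace D (A i)) ∧
        ∀ i,
          (IsFieldAlg (A i) ∧
            ((IsSimpleAlg (doubledSubspace D (A i)) ∧ IsFieldAlg (doubledSubspace D (A i))) ∨
              IsTwoCopiesOfField (doubledSubspace D (A i)) (A i))) ∨
          (IsQuaternionAlg (A i) ∧
            IsSimpleAlg (doubledSubspace D (A i)) ∧ IsCayleyAlg (doubledSubspace D (A i)))) ∧
    ((InClassL1 D ∨ InClassL2 D ∨ InClassL3 D ∨ InClassL4 D ∨ InClassL5 D) →
      ∀ n m : ℕ, IsSumOfFieldsAndQuaternionAlgs K (MonoidAlgebra K G) n m →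
        IsSumOfFieldsAndCayleyAlgs K (MonoidAlgebra K (DoubledLoop D)) (2 * n) m) := by
  -- As `|L| = 2|G|`, both `2` (for the involution arguments) and `|G|` (for Maschke's theorem) are
  -- invertible in `K`.
  have hcard : ((Nat.card (DoubledLoop D) : ℕ) : K) ≠ 0 := fun h => hK ((ringChar.spec K _).1 h)
  rw [DoubledLoop.natCard, Nat.cast_mul, Nat.cast_ofNat] at hcard
  have h2 : (2 : K) ≠ 0 := left_ne_zero_of_mul hcard
  have hσ := hRA.isCentralInvolution K h2
  have hΦ := isDoubling_loopAlgEquiv D K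
  have hc : (MonoidAlgebra.single D.g₀⁻¹ 1 : MonoidAlgebra K G) * MonoidAlgebra.single D.g₀ 1 = 1 := by
    rw [MonoidAlgebra.single_mul_single, inv_mul_cancel, one_mul, MonoidAlgebra.one_def]
  have hcc : ∀ r, (MonoidAlgebra.single D.g₀ 1 : MonoidAlgebra K G) * r =
      r * MonoidAlgebra.single D.g₀ 1 := fun r =>
    MonoidAlgebra.single_commute (fun g => (Subgroup.mem_center_iff.1 D.g₀_mem_center g).symm)
      (fun r => Commute.one_left r) r
  simp only [doubledSubspace_eq_doubled]
  refine ⟨?_, fun r A hA hs => ⟨hA.doubled hσ hΦ, fun i => ?_⟩, fun hL n m ⟨A, hA, hF, hQ⟩ => ?_⟩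
  · have : NeZero (Nat.card G : K) := ⟨right_ne_zero_of_mul hcard⟩
    exact exists_simple_decomposition K (MonoidAlgebra K G)
  · obtain ⟨e, he, -⟩ := hA.exists_units
    by_cases hcomm : ∀ x ∈ A i, ∀ y ∈ A i, x * y = y * x
    · refine .inl ⟨(he i).isFieldAlg hσ (hs i) hcomm, ?_⟩
      by_cases hw : ∃ w ∈ A i, w * w = MonoidAlgebra.single D.g₀ 1 * e i
      · exact .inr ((he i).isTwoCopiesOfField_doubled hσ hΦ hc h2 (hs i) hcomm hw)
      · have := (he i).isFieldAlg_doubled hσ hΦ (hs i) hcomm hw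
        exact .inl ⟨this.isSimpleAlg, this⟩
    · push Not at hcomm
      obtain ⟨h3, h4⟩ :=
        (he i).isQuaternionAlg_and_isCayleyAlg_doubled hσ hΦ hc hcc h2 (hs i) hcomm
      exact .inr ⟨h3, (he i).isSimpleAlg_doubled hσ hΦ hc (hs i) hcomm, h4⟩
  · obtain ⟨e, he, -⟩ := hA.exists_units
    obtain ⟨g, hg⟩ := isSquare_g₀_of_mem_classes hL
    -- With `g² = g₀`, the element `ge` of a summand with unit `e` is a square root of `g₀e`, so
    -- every field summand doubles to two fields.
    obtain ⟨J, hJ, hdec⟩ := (hA.doubled hσ hΦ).exists_refinement fun i => by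
      obtain ⟨F, _, _, -, h⟩ := (he (.inl i)).isTwoCopiesOfField_doubled hσ hΦ hc h2
        (hF i).isSimpleAlg (hF i).mul_comm ⟨MonoidAlgebra.single g 1 * e (.inl i),
          ((he _).ideal _ _ (he _).mem).1, by
            rw [mul_assoc, ← mul_assoc (e _), (he _).comm, mul_assoc, ← mul_assoc,
              (he _).mul_left _ (he _).mem, MonoidAlgebra.single_mul_single, hg, one_mul]⟩
      exact ⟨F, _, _, h⟩
    let s : Fin (2 * n) ⊕ Fin m ≃ (Fin n ⊕ Fin n) ⊕ Fin m :=
      Equiv.sumCongr ((finCongr (two_mul n)).trans finSumFinEquiv.symm) (Equiv.refl _)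
    exact ⟨_, hdec.reindex s, fun i => hJ _, fun j =>
      ((he (.inr j)).isQuaternionAlg_and_isCayleyAlg_doubled hσ hΦ hc hcc h2
        (hQ j).isSimpleAlg (hQ j).exists_mul_ne).2⟩
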